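/- A schema is a finite set of relation symbols of positive arity; a database $\mathcal D$ over a schema is a finite set of atoms $R(\bar a)$ with $\bar a$ a tuple of constants, and a relation over $\mathcal D$ is a finite set of tuples, all of the same arity $r\ge 0$, of elements occurring in $\mathcal D$. A conjunctive query (CQ) $q(\bar x)=\exists\bar y\,(R_1(\bar x_1)\wedge\dots\wedge R_m(\bar x_m))$, $m\ge 1$, has no constants, and each of its free variables $\bar x$ (a tuple in which variables may be repeated) occurs in an atom; $q(\mathcal D)$ is the set of tuples $h(\bar x)$ for $h$ a homomorphism from the atoms of $q$ to $\mathcal D$. For $k\ge 1$, $\mathsf{TW}(k)$ is the class of CQs for which the Gaifman graph of the existentially quantified variables has treewidth at most $k$. A $\mathsf{TW}(k)$-explanation for relations $S^+,S^-$ of the same arity over $\mathcal D$ is a $q\in\mathsf{TW}(k)$ of that arity with $S^+\subseteq q(\mathcal D)$ and $q(\mathcal D)\cap S^-=\emptyset$; a $\mathsf{TW}(k)$-definition of $S^+$ over $\mathcal D$ is a $q\in\mathsf{TW}(k)$ of that arity with $q(\mathcal D)=S^+$. The size of a query, database (including its schema) or relation (including its arity) is the number of symbols needed to write it down, a relation symbol,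 variable or constant counting as one symbol. Fix $k\ge 1$. The following holds. 1. There is a polynomial $p$ such that for every database $\mathcal D$ and all relations $S^+,S^-$ of the same arity over $\mathcal D$, of combined size $s$: if there is a $\mathsf{TW}(k)$-explanation for $S^+$ and $S^-$ over $\mathcal D$, then there is one of size at most $2^{2^{p(s)}}$. 2. There is a family $(\mathcal D_n,S_n^+,S_n^-)_{n\ge 0}$ of databases $\mathcal D_n$ and relations $S_n^+,S_n^-$ of the same arity over $\mathcal D_n$ such that (a) the combined size of $\mathcal D_n$, $S_n^+$ and $S_n^-$ is at most polynomial in $n$, (b) for every $n$ there is a $\mathsf{TW}(k)$-explanation for $S_n^+$ and $S_n^-$ over $\mathcal D_n$, and (c) for every $n$ the smallest such $\mathsf{TW}(k)$-explanation has size at least $2^{2^n}$. The same holds for $\mathsf{TW}(k)$-definitions: there is a polynomial $p$ such that for every database $\mathcal D$ and every relation $S^+$ over $\mathcal D$, of combined size $s$, if $S^+$ has a $\mathsf{TW}(k)$-definition over $\mathcal D$, then it has one of size at most $2^{2^{p(s)}}$; and there is a family $(\mathcal D_n,S_n^+)_{n\ge 0}$ of databases $\mathcal D_n$ and relations $S_n^+$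 over $\mathcal D_n$, of combined size at most polynomial in $n$, such that for every $n$ there is a $\mathsf{TW}(k)$-definition of $S_n^+$ over $\mathcal D_n$ and the smallest one has size at least $2^{2^n}$. -/

import Mathlib

universe u v w

namespace QBE

/-- A schema: finitely many relation symbols, each with a positive arity. -/
structure Schema where
  Rel : Type u
  [fintypeRel : Fintype Rel]
  arity : Rel → ℕ
  arity_pos : ∀ R, 0 < arity R

attribute [instance] Schema.fintypeRel

/-- The size of a schema: each symbol `R` contributes `1 + arity R`. -/
def Schema.size (σ : Schema.{u}) : ℕ := ∑ R : σ.Rel, (1 + σ.arity R)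

/-- An atom `R(t₁,…,t_m)` over `σ` with terms in `V` (constants or variables). -/
structure Atom (σ : Schema.{u}) (V : Type v) where
  rel : σ.Rel
  args : Fin (σ.arity rel) → V

namespace Atom

variable {σ : Schema.{u}} {V : Type v} {W : Type w}

/-- The number of symbols of an atom: the relation symbol and its arguments. -/
def size (a : Atom σ V) : ℕ := 1 + σ.arity a.rel

/-- The atom `R(h(t₁),…,h(t_m))`. -/
def map (h : V → W) (a : Atom σ V) : Atom σ W := ⟨a.rel, fun i => h (a.args i)⟩

/-- The term `x` occurs in the atom. -/
def Mentions (a : Atom σ V) (x : V) : Prop := ∃ i, a.args i = x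

end Atom

/-- The elements mentioned in a set of atoms. -/
def elements {σ : Schema.{u}} {V : Type v} (A : Set (Atom σ V)) : Set V :=
  {x | ∃ a ∈ A, a.Mentions x}

/-- `h` is a homomorphism from the atoms `A` to the atoms `B`. Only the values of `h` on
`elements A` matter, and `h` maps these to `elements B`. -/
def IsHom {σ : Schema.{u}} {V : Type v} {W : Type w}
    (A : Set (Atom σ V)) (B : Set (Atom σ W)) (h : V → W) : Prop :=
  ∀ a ∈ A, a.map h ∈ B

/-- A database over `σ` with constants in `C`: a finite set of atoms. -/
abbrev Database (σ : Schema.{u}) (C : Type v) := Finset (Atom σ C)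

/-- The size of a database: the number of symbols in its schema and in its atoms. -/
def Database.size {σ : Schema.{u}} {C : Type v} (D : Database σ C) : ℕ :=
  σ.size + ∑ a ∈ D, a.size

/-- `S` is a relation over `D`: all entries of its tuples are elements of `D`. -/
def IsOver {σ : Schema.{u}} {C : Type v} {n : ℕ} (S : Finset (Fin n → C))
    (D : Database σ C) : Prop :=
  ∀ t ∈ S, ∀ i, t i ∈ elements (D : Set (Atom σ C))

/-- The size of an `n`-ary relation: `1 + n` for its declaration and for each of its tuples. -/
def relationSize {C : Type v} {n : ℕ} (S : Finset (Fin n → C)) : ℕ := (1 + S.card) * (1 + n)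

/-- A tree decomposition of `G`: a finite tree `T` with a bag of vertices at each node, such that
the nodes whose bag contains a given vertex form a (nonempty) connected set, and every
edge lies inside some bag. -/
structure TreeDecomposition {V : Type v} (G : SimpleGraph V) where
  numNodes : ℕ
  T : SimpleGraph (Fin numNodes)
  isTree : T.IsTree
  bag : Fin numNodes → Finset V
  connected : ∀ x : V, (T.induce {t | x ∈ bag t}).Connected
  covers : ∀ x y : V, G.Adj x y → ∃ t, x ∈ bag t ∧ y ∈ bag t

/-- The treewidth of `G` is at most `k`: some tree decomposition has bags of size at most `k + 1`. -/
def TreewidthLE {V : Type v} (G : SimpleGraph V) (k : ℕ) : Prop :=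
  ∃ d : TreeDecomposition G, ∀ t, (d.bag t).card ≤ k + 1

/-- A conjunctive query `q(x₁,…,x_n)` over `σ`, without constants: a nonempty conjunction of atoms
over variables (natural numbers) and the tuple of its free variables, each of which
occurs in an atom. All other variables are existentially quantified. -/
structure CQ (σ : Schema.{u}) (n : ℕ) where
  atoms : List (Atom σ ℕ)
  atoms_ne_nil : atoms ≠ []
  free : Fin n → ℕ
  free_mem : ∀ i, ∃ a ∈ atoms, a.Mentions (free i)

namespace CQ

variable {σ : Schema.{u}} {n : ℕ}

/-- The canonical database of `q`. -/
def canonicalDB (q : CQ σ n) : Set (Atom σ ℕ) := {a | a ∈ q.atoms}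

/-- The evaluation of `q` over `D`: the tuples `h(x̄)`, for `h` a homomorphism from the canonical
database of `q` to `D`. -/
def eval {C : Type v} (q : CQ σ n) (D : Database σ C) : Set (Fin n → C) :=
  {t | ∃ h : ℕ → C, IsHom q.canonicalDB (D : Set (Atom σ C)) h ∧ t = fun i => h (q.free i)}

/-- The number of symbols of `q`: its free variables and its atoms. -/
def size (q : CQ σ n) : ℕ := n + (q.atoms.map Atom.size).sum

/-- The set of existentially quantified variables of `q`. -/
def existentialVars (q : CQ σ n) : Set ℕ := elements q.canonicalDB \ Set.range q.free

/-- The Gaifman graph of the existentially quantified variables of `q`. -/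
def gaifmanGraph (q : CQ σ n) : SimpleGraph q.existentialVars where
  Adj y z := y ≠ z ∧ ∃ a ∈ q.atoms, a.Mentions y ∧ a.Mentions z
  symm := ⟨fun _ _ h => ⟨h.1.symm, h.2.imp fun _ ha => ⟨ha.1, ha.2.2, ha.2.1⟩⟩⟩
  loopless := ⟨fun _ h => h.1 rfl⟩

end CQ

/-- The class `TW(k)` of conjunctive queries of treewidth at most `k`. -/
def TW (σ : Schema.{u}) (n k : ℕ) : Set (CQ σ n) := {q | TreewidthLE q.gaifmanGraph k}

/-- An input of the definability problem: a database `D` and a relation `pos` over `D`. -/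
structure DefinabilityInput where
  σ : Schema.{u}
  C : Type v
  D : Database σ C
  arity : ℕ
  pos : Finset (Fin arity → C)
  pos_over : IsOver pos D

/-- An input of the query-by-example problem: a database `D` and relations `pos`, `neg` of the same
arity over `D`. -/
structure QBEInput extends DefinabilityInput.{u, v} where
  neg : Finset (Fin arity → C)
  neg_over : IsOver neg D

/-- The combined size of `D` and `pos`. -/
def DefinabilityInput.size (I : DefinabilityInput.{u, v}) : ℕ := I.D.size + relationSize I.pos

/-- The combined size of `D`, `pos` and `neg`. -/
def QBEInput.size (I : QBEInput.{u, v}) : ℕ :=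
  I.D.size + relationSize I.pos + relationSize I.neg

/-- The `TW(k)`-explanations for `pos` and `neg` over `D`. -/
def QBEInput.explanations (I : QBEInput.{u, v}) (k : ℕ) : Set (CQ I.σ I.arity) :=
  {q | q ∈ TW I.σ I.arity k ∧ (I.pos : Set (Fin I.arity → I.C)) ⊆ q.eval I.D ∧
    q.eval I.D ∩ (I.neg : Set (Fin I.arity → I.C)) = ∅}

/-- The `TW(k)`-definitions of `pos` over `D`. -/
def DefinabilityInput.definitions (I : DefinabilityInput.{u, v}) (k : ℕ) :
    Set (CQ I.σ I.arity) :=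
  {q | q ∈ TW I.σ I.arity k ∧ q.eval I.D = (I.pos : Set (Fin I.arity → I.C))}

end QBE

/-! Upper bound. Let `q₀` be a query in TW(k) that holds of all positive tuples, and let `E` be the
set of elements of the database. A query holds of all positive tuples iff it holds of their
combination in the direct power of `E` indexed by these tuples. To separate this combination from a
tuple `b` over `E`, one plays the existential (k+1)-pebble game from the power to `E`. If Duplicator
survives forever, her answers can be glued along a tree decomposition of `q₀` to a homomorphism, so
`q₀` holds of `b`. Otherwise Spoiler wins within as many rounds as there are positions, which is
single exponential, and his strategy unfolds into a formula with k+1 reusable variables that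
branches over Duplicator's answers and hence has double exponential size
(`CQ.exists_fm_of_not_isHom`). Giving fresh names to requantified variables turns such a formula
into a query in TW(k) (`Fm.exists_cq`). The conjunction of these formulas over all `b` missed by
`q₀` can replace `q₀`, both as an explanation and as a definition (`exists_small_cq`).

Lower bound. The negative examples are built so that every explanation demands, below its free
variable, children for all 2k edge labels along every path until a mark is met (`forced_free`).
Positive examples on cycles of lengths 1, ..., m allow marks only at depths congruent to -1 modulo
lcm(1, ..., m), which is exponential in m. Unfolded, such a query is a tree of double exponential
size, but its variables might be shared between branches. Treewidth limits the sharing: the Gaifman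
graph has an orientation with out-degrees at most k, while each variable has 2k distinct children,
so the number of variables in the first i levels at least doubles with each i (`two_mul_card_le`).
Conversely, the full 2k-ary tree of depth m! - 1 with marked leaves defines the positive examples
(`exists_definition`). -/

namespace QBE

/-! ### Tree decompositions as sequences of bags -/

open SimpleGraph in
/-- In a graph whose induced subgraph on `s` is preconnected, two points of `s` are joined by a path
inside `s`. -/
theorem exists_isPath_of_preconnected_induce {V : Type v} {G : SimpleGraph V} {s : Set V}
    (hs : (G.induce s).Preconnected) {a b : V} (ha : a ∈ s) (hb : b ∈ s) :
    ∃ p : G.Walk a b, p.IsPath ∧ ∀ x ∈ p.support, x ∈ s := by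
  classical
  obtain ⟨p⟩ := hs ⟨a, ha⟩ ⟨b, hb⟩
  have hq : ∀ x ∈ (p.map (Embedding.induce s).toHom).support, x ∈ s := by
    intro x hx
    rw [Walk.support_map, List.mem_map] at hx
    obtain ⟨y, -, rfl⟩ := hx
    exact y.2
  exact ⟨(p.map (Embedding.induce s).toHom).bypass, Walk.bypass_isPath _, fun x hx =>
    hq x (Walk.support_bypass_subset_support _ hx)⟩

open SimpleGraph in
/-- If `s` is connected in an acyclic graph and `t ∉ s` is adjacent to `j ∈ s`, then every connected set
that contains `t` and meets `s` contains `j`. -/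
theorem mem_of_preconnected_of_adj {V : Type v} {G : SimpleGraph V} (hG : G.IsAcyclic) {s S : Set V}
    (hs : (G.induce s).Preconnected) (hS : (G.induce S).Preconnected) {t j t' : V} (ht : t ∉ s)
    (hj : j ∈ s) (hadj : G.Adj t j) (htS : t ∈ S) (ht'S : t' ∈ S) (ht' : t' ∈ s) : j ∈ S := by
  obtain ⟨p, hp, hpS⟩ := exists_isPath_of_preconnected_induce hS ht'S htS
  obtain ⟨q, hq, hqs⟩ := exists_isPath_of_preconnected_induce hs ht' hj
  exact hpS _ (hG.mem_support_of_ne_mem_support_of_adj_of_isPath hp hq hadj fun h => ht (hqs _ h))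

/-- A sequence of bags of size at most `k + 1`, latest first, in which each bag meets the union of its
predecessors inside a single predecessor (or not at all). -/
inductive BagSeq {V : Type v} (k : ℕ) : List (Finset V) → Prop
  | nil : BagSeq k []
  | cons (B P : Finset V) (L : List (Finset V)) (hL : BagSeq k L) (hP : P ∈ ∅ :: L)
      (hB : ∀ x ∈ B, ∀ Q ∈ L, x ∈ Q → x ∈ P) (hk : B.card ≤ k + 1) : BagSeq k (B :: L)

namespace BagSeq

variable {V : Type v} {k : ℕ}

theorem card_le {L : List (Finset V)} (h : BagSeq k L) : ∀ B ∈ L, B.card ≤ k + 1 := by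
  induction h with
  | nil => simp
  | cons B P L hL hP hB hk ih => simpa using ⟨hk, ih⟩

/-- The bags of a tree decomposition, in an order in which the nodes are found from a root. -/
theorem exists_of_treewidthLE {G : SimpleGraph V} (h : TreewidthLE G k) :
    ∃ L : List (Finset V), BagSeq k L ∧ (∀ x, ∃ B ∈ L, x ∈ B) ∧
      ∀ x y, G.Adj x y → ∃ B ∈ L, x ∈ B ∧ y ∈ B := by
  classical
  obtain ⟨d, hd⟩ := h
  -- The set `s` of nodes listed so far is kept connected. An edge leaving `s` supplies the next
  -- node, and the bag of its endpoint in `s` serves as the predecessor bag. The induction is on the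
  -- number of nodes still missing.
  have key : ∀ n (s : Finset (Fin d.numNodes)), (Finset.univ \ s).card = n →
      (d.T.induce (s : Set (Fin d.numNodes))).Connected →
      (∃ L : List (Finset V), BagSeq k L ∧ ∀ B, B ∈ L ↔ ∃ t ∈ s, d.bag t = B) →
      ∃ L : List (Finset V), BagSeq k L ∧ ∀ t, d.bag t ∈ L := by
    intro n
    induction n with
    | zero =>
      rintro s hs - ⟨L, hL, hB⟩
      refine ⟨L, hL, fun t => (hB _).2 ⟨t, ?_, rfl⟩⟩
      by_contra ht
      have : t ∈ Finset.univ \ s := by simp [ht]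
      rw [Finset.card_eq_zero.1 hs] at this
      simp at this
    | succ n ih =>
      rintro s hs hconn ⟨L, hL, hB⟩
      obtain ⟨t₀, ht₀⟩ : (Finset.univ \ s).Nonempty := by
        rw [← Finset.card_pos]; omega
      obtain ⟨⟨r, hr⟩⟩ := hconn.nonempty
      obtain ⟨w⟩ := d.isTree.connected.preconnected r t₀
      obtain ⟨e, -, he, he'⟩ := w.exists_boundary_dart (s : Set (Fin d.numNodes)) hr
        (by simpa using ht₀)
      have heS : e.snd ∉ s := by simpa using he'
      refine ih (insert e.snd s) ?_ ?_ ⟨d.bag e.snd :: L, ?_, ?_⟩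
      · have : Finset.univ \ insert e.snd s = (Finset.univ \ s).erase e.snd := by
          ext; simp
        rw [this, Finset.card_erase_of_mem (by simpa using heS)]
        omega
      · have h1 : (d.T.induce ({e.snd} : Set (Fin d.numNodes))).Preconnected := by
          rintro ⟨a, rfl⟩ ⟨b, rfl⟩
          exact .refl _
        have := SimpleGraph.connected_induce_union h1 hconn.preconnected
          (Set.mem_singleton e.snd) he e.adj.symm
        rw [Finset.coe_insert, Set.insert_eq]
        exact this
      · refine .cons _ (d.bag e.fst) _ hL (List.mem_cons_of_mem _ ((hB _).2 ⟨_, he, rfl⟩)) ?_ (hd _)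
        intro x hx Q hQ hxQ
        obtain ⟨t', ht', rfl⟩ := (hB _).1 hQ
        exact mem_of_preconnected_of_adj (S := {t | x ∈ d.bag t}) d.isTree.isAcyclic
          hconn.preconnected (d.connected x).preconnected heS he e.adj.symm hx hxQ ht'
      · intro B
        simp [hB, eq_comm]
  obtain ⟨⟨r⟩⟩ : Nonempty (Nonempty (Fin d.numNodes)) := ⟨d.isTree.connected.nonempty⟩
  obtain ⟨L, hL, hLt⟩ := key _ {r} rfl
    (by
      have : Nonempty (({r} : Finset (Fin d.numNodes)) : Set (Fin d.numNodes)) := ⟨⟨r, by simp⟩⟩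
      refine ⟨?_⟩
      rintro ⟨a, ha⟩ ⟨b, hb⟩
      simp only [Finset.coe_singleton, Set.mem_singleton_iff] at ha hb
      subst ha; subst hb
      exact .refl _)
    ⟨[d.bag r], .cons _ ∅ _ .nil (by simp) (by simp) (hd _), by simp [eq_comm]⟩
  refine ⟨L, hL, fun x => ?_, fun x y hxy => ?_⟩
  · obtain ⟨⟨t, ht⟩⟩ := (d.connected x).nonempty
    exact ⟨_, hLt t, ht⟩
  · obtain ⟨t, ht⟩ := d.covers x y hxy
    exact ⟨_, hLt t, ht⟩

/-- A nonempty bag sequence is arranged in a tree on `{0, …, n - 1}`. -/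
theorem exists_tree {L : List (Finset V)} (h : BagSeq k L) (hne : L ≠ []) :
    ∃ (n : ℕ) (T : SimpleGraph ℕ) (bag : ℕ → Finset V), T.IsAcyclic ∧
      (∀ a b, T.Adj a b → a < n ∧ b < n) ∧ (T.induce {i | i < n}).Connected ∧
      (∀ x i, i < n → x ∈ bag i → (T.induce {i | i < n ∧ x ∈ bag i}).Connected) ∧
      ∀ B, B ∈ L ↔ ∃ i < n, bag i = B := by
  classical
  have single : ∀ (T : SimpleGraph ℕ) (s : Set ℕ) (a : ℕ), s = {a} → (T.induce s).Connected := by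
    rintro T s a rfl
    have : Nonempty ({a} : Set ℕ) := ⟨⟨a, rfl⟩⟩
    refine ⟨?_⟩
    rintro ⟨b, rfl⟩ ⟨c, rfl⟩
    exact .refl _
  induction h with
  | nil => exact absurd rfl hne
  | cons B P L hL hP hB hk ih =>
    by_cases hLe : L = []
    · subst hLe
      refine ⟨1, ⊥, fun _ => B, SimpleGraph.isAcyclic_bot, by simp, single _ _ 0 (by ext; simp), ?_, ?_⟩
      · intro x i _ hx
        exact single _ _ 0 (by ext; simp_all)
      · intro B'
        simp only [List.mem_singleton]
        exact ⟨fun h => ⟨0, by simp, h.symm⟩, fun ⟨_, _, h⟩ => h.symm⟩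
    obtain ⟨n, T, bag, hacyc, hadj, hconn, hbag, hmem⟩ := ih hLe
    -- The new node `n` becomes a leaf attached to a node whose bag contains `P`; if `P` is the
    -- empty default, any node will do.
    obtain ⟨i₀, hi₀, hi₀P⟩ : ∃ i₀ < n, ∀ x ∈ P, x ∈ bag i₀ := by
      rcases List.mem_cons.1 hP with rfl | hP
      · obtain ⟨⟨i, hi⟩⟩ := hconn.nonempty
        exact ⟨i, hi, by simp⟩
      · obtain ⟨i, hi, rfl⟩ := (hmem P).1 hP
        exact ⟨i, hi, fun _ h => h⟩
    have hne' : n ≠ i₀ := by omega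
    set T' := T ⊔ SimpleGraph.edge n i₀ with hT'
    have hTT' : T ≤ T' := le_sup_left
    have hadj' : T'.Adj n i₀ := by
      rw [hT', SimpleGraph.sup_adj, SimpleGraph.edge_adj]; simp [hne']
    have mono : ∀ s : Set ℕ, (T.induce s).Connected → (T'.induce s).Connected := fun s hs =>
      hs.mono (fun a b hab => hTT' hab)
    set bag' : ℕ → Finset V := fun i => if i = n then B else bag i with hbag'
    have hb1 : bag' n = B := by simp [hbag']
    have hb2 : ∀ i, i < n → bag' i = bag i := fun i hi => by simp [hbag', hi.ne]
    refine ⟨n + 1, T', bag', ?_, ?_, ?_, ?_, ?_⟩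
    · refine SimpleGraph.IsAcyclic.sup_edge_of_not_reachable ?_ hacyc
      rintro ⟨w⟩
      cases w with
      | nil => omega
      | cons h _ => exact absurd (hadj _ _ h).1 (lt_irrefl _)
    · intro a b hab
      rw [hT', SimpleGraph.sup_adj, SimpleGraph.edge_adj] at hab
      rcases hab with hab | hab
      · have := hadj _ _ hab; omega
      · omega
    · have := SimpleGraph.connected_induce_union (single T' {n} n rfl).preconnected
        (mono _ hconn).preconnected (Set.mem_singleton n) hi₀ hadj'
      convert this using 2 <;> (ext i; simp; omega)
    · intro x i hi hx
      by_cases hxL : ∃ j < n, x ∈ bag j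
      · obtain ⟨j, hj, hxj⟩ := hxL
        have h1 := mono _ (hbag x j hj hxj)
        by_cases hxB : x ∈ B
        · have hx0 : x ∈ bag i₀ := hi₀P _ (hB _ hxB _ ((hmem _).2 ⟨j, hj, rfl⟩) hxj)
          have h2 := SimpleGraph.connected_induce_union (single T' {n} n rfl).preconnected
            h1.preconnected (Set.mem_singleton n) (show i₀ ∈ {i | i < n ∧ x ∈ bag i} from ⟨hi₀, hx0⟩) hadj'
          have hset : {i | i < n + 1 ∧ x ∈ bag' i} = {n} ∪ {i | i < n ∧ x ∈ bag i} := by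
            ext i
            rcases lt_trichotomy i n with h | h | h
            · simp [hb2 i h, h.ne, h]; omega
            · subst h; simp [hb1, hxB]
            · simp; omega
          rw [hset]; exact h2
        · have hset : {i | i < n + 1 ∧ x ∈ bag' i} = {i | i < n ∧ x ∈ bag i} := by
            ext i
            rcases lt_trichotomy i n with h | h | h
            · simp [hb2 i h, h]; omega
            · subst h; simp [hb1, hxB]
            · simp; omega
          rw [hset]; exact h1
      · have hxB : x ∈ B := by
          rcases Nat.lt_succ_iff_lt_or_eq.1 hi with h | h
          · exact absurd ⟨i, h, by rwa [hb2 i h] at hx⟩ hxL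
          · subst h; rwa [hb1] at hx
        refine single _ _ n ?_
        ext i
        rcases lt_trichotomy i n with h | h | h
        · simp only [Set.mem_ofPred_eq, hb2 i h, Set.mem_singleton_iff, h.ne, iff_false]
          exact fun h' => hxL ⟨i, h, h'.2⟩
        · subst h; simp [hb1, hxB]
        · simp; omega
    · intro B'
      rw [List.mem_cons, hmem]
      constructor
      · rintro (rfl | ⟨i, hi, rfl⟩)
        · exact ⟨n, by omega, hb1⟩
        · exact ⟨i, by omega, hb2 i hi⟩
      · rintro ⟨i, hi, rfl⟩
        rcases Nat.lt_succ_iff_lt_or_eq.1 hi with h | h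
        · exact .inr ⟨i, h, (hb2 i h).symm⟩
        · subst h; exact .inl hb1

theorem treewidthLE {G : SimpleGraph V} {L : List (Finset V)} (h : BagSeq k L)
    (hv : ∀ x, ∃ B ∈ L, x ∈ B) (he : ∀ x y, G.Adj x y → ∃ B ∈ L, x ∈ B ∧ y ∈ B) :
    TreewidthLE G k := by
  -- A tree has at least one node, so an empty bag is added in case `L` is empty.
  have h' : BagSeq k (∅ :: L) := .cons ∅ ∅ L h (by simp) (by simp) (by simp)
  obtain ⟨n, T, bag, hacyc, -, hconn, hbag, hmem⟩ := h'.exists_tree (by simp)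
  have iso : ∀ s : Set ℕ, (∀ i ∈ s, i < n) → (T.induce s).Connected →
      ((T.comap (Fin.val : Fin n → ℕ)).induce {t : Fin n | (t : ℕ) ∈ s}).Connected := by
    intro s hs hc
    let e : (T.comap (Fin.val : Fin n → ℕ)).induce {t : Fin n | (t : ℕ) ∈ s} ≃g T.induce s :=
      { toFun := fun t => ⟨t.1.1, t.2⟩
        invFun := fun t => ⟨⟨t.1, hs _ t.2⟩, t.2⟩
        left_inv := fun _ => rfl
        right_inv := fun _ => rfl
        map_rel_iff' := Iff.rfl }
    exact (SimpleGraph.Iso.connected_iff e).2 hc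
  have hcard : ∀ t : Fin n, (bag t).card ≤ k + 1 := fun t => h'.card_le _ ((hmem _).2 ⟨t, t.2, rfl⟩)
  refine ⟨⟨n, T.comap Fin.val, ⟨?_, ?_⟩, fun t => bag t, ?_, ?_⟩, hcard⟩
  · let e : T.comap (Fin.val : Fin n → ℕ) ≃g T.induce {i | i < n} :=
      { toFun := fun t => ⟨t.1, t.2⟩
        invFun := fun t => ⟨t.1, t.2⟩
        left_inv := fun _ => rfl
        right_inv := fun _ => rfl
        map_rel_iff' := Iff.rfl }
    exact (SimpleGraph.Iso.connected_iff e).2 hconn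
  · exact SimpleGraph.IsAcyclic.of_comap (Fin.valEmbedding) hacyc
  · intro x
    obtain ⟨B, hB, hx⟩ := hv x
    obtain ⟨i, hi, rfl⟩ := (hmem B).1 (List.mem_cons_of_mem _ hB)
    have := iso _ (fun i hi => hi.1) (hbag x i hi hx)
    have hset : {t : Fin n | x ∈ bag t} = {t : Fin n | (t : ℕ) ∈ {i | i < n ∧ x ∈ bag i}} :=
      Set.ext fun t => by simp
    rw [hset]
    exact this
  · intro x y hxy
    obtain ⟨B, hB, hx⟩ := he x y hxy
    obtain ⟨i, hi, rfl⟩ := (hmem B).1 (List.mem_cons_of_mem _ hB)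
    exact ⟨⟨i, hi⟩, hx⟩

/-- A set of vertices that pairwise share a bag is contained in a bag. -/
theorem exists_bag_of_clique {L : List (Finset V)} (h : BagSeq k L) (K : V → Prop)
    (hK : ∀ x y, K x → K y → ∃ B ∈ L, x ∈ B ∧ y ∈ B) : ∃ B ∈ ∅ :: L, ∀ x, K x → x ∈ B := by
  induction h with
  | nil =>
    refine ⟨∅, by simp, fun x hx => ?_⟩
    obtain ⟨B, hB, -⟩ := hK x x hx hx
    simp at hB
  | cons B P L hL hP hB hk ih =>
    -- A clique element that is new in `B` shares bags only with elements of `B`. If there is none,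
    -- a pair that meets in `B` consists of old elements and already meets in `P`.
    by_cases hnew : ∃ x, K x ∧ ∀ Q ∈ L, x ∉ Q
    · obtain ⟨x, hx, hxQ⟩ := hnew
      refine ⟨B, by simp, fun y hy => ?_⟩
      obtain ⟨Q, hQ, hxQ', hyQ⟩ := hK x y hx hy
      rcases List.mem_cons.1 hQ with rfl | hQ
      · exact hyQ
      · exact absurd hxQ' (hxQ _ hQ)
    · push Not at hnew
      obtain ⟨Q, hQ, h⟩ := ih (by
        intro x y hx hy
        obtain ⟨Q, hQ, hxQ, hyQ⟩ := hK x y hx hy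
        rcases List.mem_cons.1 hQ with rfl | hQ
        · obtain ⟨Q1, hQ1, hx1⟩ := hnew x hx
          obtain ⟨Q2, hQ2, hx2⟩ := hnew y hy
          have hxP := hB x hxQ _ hQ1 hx1
          have hyP := hB y hyQ _ hQ2 hx2
          rcases List.mem_cons.1 hP with rfl | hP
          · simp at hxP
          · exact ⟨P, hP, hxP, hyP⟩
        · exact ⟨Q, hQ, hxQ, hyQ⟩)
      exact ⟨Q, by simp at hQ ⊢; tauto, h⟩

/-- The pairs of vertices that share a bag can be oriented such that all out-degrees are at most `k`. -/
theorem exists_orientation {L : List (Finset V)} (h : BagSeq k L) :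
    ∃ N : V → Finset V, (∀ x, (N x).card ≤ k) ∧
      ∀ B ∈ L, ∀ x ∈ B, ∀ y ∈ B, x ≠ y → y ∈ N x ∨ x ∈ N y := by
  classical
  induction h with
  | nil => exact ⟨fun _ => ∅, by simp, by simp⟩
  | cons B P L hL hP hB hk ih =>
    obtain ⟨N, hN, hL'⟩ := ih
    -- Each vertex points to the other elements of the bag that introduces it, at most `k` many. Two
    -- old vertices of `B` both lie in `P`, so they are oriented already.
    refine ⟨fun x => if (∃ Q ∈ L, x ∈ Q) then N x else if x ∈ B then B.erase x else ∅, ?_, ?_⟩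
    · intro x
      dsimp only
      split_ifs with h1 h2
      · exact hN x
      · rw [Finset.card_erase_of_mem h2]; omega
      · simp
    · intro Q hQ x hx y hy hxy
      rcases List.mem_cons.1 hQ with rfl | hQ
      · by_cases h1 : ∃ Q ∈ L, x ∈ Q
        · by_cases h2 : ∃ Q ∈ L, y ∈ Q
          · simp only [h1, h2, if_true]
            obtain ⟨Q1, hQ1, hx1⟩ := h1
            obtain ⟨Q2, hQ2, hx2⟩ := h2
            have hxP := hB x hx _ hQ1 hx1
            have hyP := hB y hy _ hQ2 hx2
            rcases List.mem_cons.1 hP with rfl | hP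
            · simp at hxP
            · exact hL' P hP x hxP y hyP hxy
          · right; simp only [h2, hy, if_true, if_false]; simp [hx, hxy]
        · left; simp only [h1, hx, if_true, if_false]; simp [hy, hxy.symm]
      · have h1 : ∃ Q ∈ L, x ∈ Q := ⟨Q, hQ, hx⟩
        have h2 : ∃ Q ∈ L, y ∈ Q := ⟨Q, hQ, hy⟩
        simp only [h1, h2, if_true]
        exact hL' Q hQ x hx y hy hxy

end BagSeq

end QBE

/-! ### Formulas with reusable variables and their prenex forms -/

namespace QBE

namespace Atom

variable {σ : Schema.{u}} {V : Type v} {W : Type w}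

theorem map_map {X : Type*} (g : W → X) (f : V → W) (a : Atom σ V) :
    (a.map f).map g = a.map (g ∘ f) := rfl

theorem map_congr {f g : V → W} {a : Atom σ V} (h : ∀ x, a.Mentions x → f x = g x) :
    a.map f = a.map g := by
  unfold Atom.map
  congr 1
  exact funext fun i => h _ ⟨i, rfl⟩

theorem mentions_map {f : V → W} {a : Atom σ V} {y : W} :
    (a.map f).Mentions y ↔ ∃ x, a.Mentions x ∧ f x = y :=
  ⟨fun ⟨i, hi⟩ => ⟨a.args i, ⟨i, rfl⟩, hi⟩, fun ⟨_, ⟨i, hi⟩, hx⟩ => ⟨i, by rw [← hx, ← hi]; rfl⟩⟩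

end Atom

/-- Existential positive formulas without disjunction, with free variables `F` and `m` reusable
variables. The quantifier `ex f` rebinds all `m` variables at once: the variable `i` keeps the value of
the variable `j` if `f i = some j`, and is existentially quantified if `f i = none`. -/
inductive Fm (σ : Schema.{u}) (F : Type v) (m : ℕ)
  | tru : Fm σ F m
  | atom (a : Atom σ (F ⊕ Fin m)) : Fm σ F m
  | and (φ ψ : Fm σ F m) : Fm σ F m
  | ex (f : Fin m → Option (Fin m)) (φ : Fm σ F m) : Fm σ F m

namespace Fm

variable {σ : Schema.{u}} {F : Type v} {m : ℕ}

/-- The number of symbols in the atoms of a formula. -/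
def size : Fm σ F m → ℕ
  | tru => 0
  | atom a => a.size
  | and φ ψ => φ.size + ψ.size
  | ex _ φ => φ.size

/-- The atom `a` occurs in the formula. -/
def HasAtom (a : Atom σ (F ⊕ Fin m)) : Fm σ F m → Prop
  | tru => False
  | atom b => b = a
  | and φ ψ => φ.HasAtom a ∨ ψ.HasAtom a
  | ex _ φ => φ.HasAtom a

/-- Rebinding `d` along `f` may give `d'`. -/
def Rebinds {V : Type w} (f : Fin m → Option (Fin m)) (d d' : Fin m → V) : Prop :=
  ∀ i j, f i = some j → d' i = d j

/-- Satisfaction of a formula in the structure with the set of atoms `A`. -/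
def Sat {V : Type w} (A : Set (Atom σ V)) (e : F → V) : Fm σ F m → (Fin m → V) → Prop
  | tru, _ => True
  | atom a, d => a.map (Sum.elim e d) ∈ A
  | and φ ψ, d => φ.Sat A e d ∧ ψ.Sat A e d
  | ex f φ, d => ∃ d', Rebinds f d d' ∧ φ.Sat A e d'

/-- The conjunction of a list of formulas. -/
def conj : List (Fm σ F m) → Fm σ F m
  | [] => tru
  | φ :: l => and φ (conj l)

theorem sat_conj {V : Type w} {A : Set (Atom σ V)} {e : F → V} {d : Fin m → V}
    {l : List (Fm σ F m)} : (conj l).Sat A e d ↔ ∀ φ ∈ l, φ.Sat A e d := by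
  induction l with
  | nil => simp [conj, Sat]
  | cons φ l ih => simp [conj, Sat, ih]

theorem hasAtom_conj {a : Atom σ (F ⊕ Fin m)} {l : List (Fm σ F m)} :
    (conj l).HasAtom a ↔ ∃ φ ∈ l, φ.HasAtom a := by
  induction l with
  | nil => simp [conj, HasAtom]
  | cons φ l ih => simp [conj, HasAtom, ih]

theorem size_conj_le {l : List (Fm σ F m)} {c : ℕ} (h : ∀ φ ∈ l, φ.size ≤ c) :
    (conj l).size ≤ l.length * c := by
  induction l with
  | nil => simp [conj, size]
  | cons φ l ih =>
    have h1 := h φ (by simp)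
    have h2 := ih fun ψ hψ => h ψ (by simp [hψ])
    simp only [conj, size, List.length_cons]
    linarith [Nat.succ_mul l.length c]

/-- The names of the rebound variables: those quantified anew get fresh names from `N` on. -/
def rebind (f : Fin m → Option (Fin m)) (ρ : Fin m → ℕ) (N : ℕ) (i : Fin m) : ℕ :=
  match f i with
  | some j => ρ j
  | none => N + i

/-- The first variable name not used in the atoms of the formula, if naming starts at `N`. -/
def next : Fm σ F m → ℕ → ℕ
  | tru, N => N
  | atom _, N => N
  | and φ ψ, N => ψ.next (φ.next N)
  | ex _ φ, N => φ.next (N + m)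

/-- The atoms of the prenex form of a formula, where the free variables are named by `u`, the reusable
variables by `ρ`, and the quantified ones get fresh names from `N` on. -/
def atoms (u : F → ℕ) : Fm σ F m → (Fin m → ℕ) → ℕ → List (Atom σ ℕ)
  | tru, _, _ => []
  | atom a, ρ, _ => [a.map (Sum.elim u ρ)]
  | and φ ψ, ρ, N => φ.atoms u ρ N ++ ψ.atoms u ρ (φ.next N)
  | ex f φ, ρ, N => φ.atoms u (rebind f ρ N) (N + m)

variable {u : F → ℕ}

theorem le_next (φ : Fm σ F m) (N : ℕ) : N ≤ φ.next N := by
  induction φ generalizing N with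
  | tru => exact le_rfl
  | atom a => exact le_rfl
  | and φ ψ ih1 ih2 => exact (ih1 N).trans (ih2 _)
  | ex f φ ih => exact (Nat.le_add_right N m).trans (ih _)

theorem rebind_lt {f : Fin m → Option (Fin m)} {ρ : Fin m → ℕ} {N : ℕ} (hρ : ∀ i, ρ i < N) (i : Fin m) :
    rebind f ρ N i < N + m := by
  unfold rebind
  split
  · exact (hρ _).trans_le (Nat.le_add_right _ _)
  · omega

theorem size_atoms (φ : Fm σ F m) (ρ : Fin m → ℕ) (N : ℕ) :
    ((φ.atoms u ρ N).map Atom.size).sum = φ.size := by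
  induction φ generalizing N ρ with
  | tru => rfl
  | atom a => simp [atoms, size, Atom.size, Atom.map]
  | and φ ψ ih1 ih2 => simp [atoms, size, ih1, ih2]
  | ex f φ ih => exact ih _ _

theorem exists_mem_atoms {a : Atom σ (F ⊕ Fin m)} {φ : Fm σ F m} (h : φ.HasAtom a) (ρ : Fin m → ℕ)
    (N : ℕ) : ∃ ρ', a.map (Sum.elim u ρ') ∈ φ.atoms u ρ N := by
  induction φ generalizing N ρ with
  | tru => exact h.elim
  | atom b => exact ⟨ρ, by obtain rfl : b = a := h; simp [atoms]⟩
  | and φ ψ ih1 ih2 =>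
    rcases h with h | h
    · obtain ⟨ρ', h'⟩ := ih1 h ρ N
      exact ⟨ρ', List.mem_append_left _ h'⟩
    · obtain ⟨ρ', h'⟩ := ih2 h ρ (φ.next N)
      exact ⟨ρ', List.mem_append_right _ h'⟩
  | ex f φ ih => exact ih h _ _

theorem sat_of_isHom {V : Type w} {A : Set (Atom σ V)} {h : ℕ → V} (φ : Fm σ F m) (ρ : Fin m → ℕ)
    (N : ℕ) (hh : ∀ a ∈ φ.atoms u ρ N, a.map h ∈ A) : φ.Sat A (h ∘ u) (h ∘ ρ) := by
  induction φ generalizing N ρ with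
  | tru => trivial
  | atom a =>
    have := hh _ (List.mem_singleton_self _)
    rwa [Atom.map_map, Sum.comp_elim] at this
  | and φ ψ ih1 ih2 =>
    exact ⟨ih1 _ _ fun a ha => hh a (List.mem_append_left _ ha),
      ih2 _ _ fun a ha => hh a (List.mem_append_right _ ha)⟩
  | ex f φ ih =>
    exact ⟨h ∘ rebind f ρ N, fun i j hij => by simp [rebind, hij], ih _ _ hh⟩

/-- The conclusion speaks of every `h''` that agrees with `h'` on the names used so far. This lets
the second conjunct of a conjunction assign its own fresh names without spoiling the first. -/
theorem exists_isHom_of_sat {V : Type w} {A : Set (Atom σ V)} (φ : Fm σ F m) (ρ : Fin m → ℕ)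
    (N : ℕ) (hρ : ∀ i, ρ i < N) (hu : ∀ i, u i < N) (h : ℕ → V) (hs : φ.Sat A (h ∘ u) (h ∘ ρ)) :
    ∃ h' : ℕ → V, (∀ x < N, h' x = h x) ∧
      ∀ h'' : ℕ → V, (∀ x < φ.next N, h'' x = h' x) → ∀ a ∈ φ.atoms u ρ N, a.map h'' ∈ A := by
  induction φ generalizing N ρ h with
  | tru => exact ⟨h, fun _ _ => rfl, by simp [atoms]⟩
  | atom a =>
    refine ⟨h, fun _ _ => rfl, fun h'' hh b hb => ?_⟩
    obtain rfl := List.mem_singleton.1 hb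
    rw [Atom.map_map, Sum.comp_elim]
    have h1 : h'' ∘ u = h ∘ u := funext fun i => hh _ (hu i)
    have h2 : h'' ∘ ρ = h ∘ ρ := funext fun i => hh _ (hρ i)
    rw [h1, h2]
    exact hs
  | and φ ψ ih1 ih2 =>
    obtain ⟨h1, h1N, h1A⟩ := ih1 ρ N hρ hu h hs.1
    have hle := φ.le_next N
    obtain ⟨h2, h2N, h2A⟩ := ih2 ρ (φ.next N) (fun i => (hρ i).trans_le hle)
      (fun i => (hu i).trans_le hle) h1 (by
        have e1 : h1 ∘ u = h ∘ u := funext fun i => h1N _ (hu i)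
        have e2 : h1 ∘ ρ = h ∘ ρ := funext fun i => h1N _ (hρ i)
        rw [e1, e2]; exact hs.2)
    refine ⟨h2, fun x hx => (h2N x (hx.trans_le hle)).trans (h1N x hx), fun h'' hh a ha => ?_⟩
    rcases List.mem_append.1 ha with ha | ha
    · refine h1A h'' (fun x hx => ?_) a ha
      rw [hh x (hx.trans_le (ψ.le_next _)), h2N x hx]
    · exact h2A h'' hh a ha
  | ex f φ ih =>
    obtain ⟨d', hd', hs⟩ := hs
    -- The names from `N` to `N + m - 1` are reserved for this quantifier and receive its witnesses.
    let g : ℕ → V := fun x => if hx : N ≤ x ∧ x - N < m then d' ⟨x - N, hx.2⟩ else h x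
    have gN : ∀ x < N, g x = h x := fun x hx => dif_neg (by omega)
    have g1 : g ∘ u = h ∘ u := funext fun i => gN _ (hu i)
    have g2 : g ∘ rebind f ρ N = d' := by
      funext i
      cases hf : f i with
      | some j =>
        simp only [Function.comp, rebind, hf]
        rw [gN _ (hρ j), hd' i j hf]; rfl
      | none =>
        simp [Function.comp, rebind, hf, g]
    obtain ⟨h', h'N, h'A⟩ := ih (rebind f ρ N) (N + m) (rebind_lt hρ)
      (fun i => (hu i).trans_le (Nat.le_add_right _ _)) g (by rw [g1, g2]; exact hs)
    exact ⟨h', fun x hx => (h'N x (by omega)).trans (gN x hx), h'A⟩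

/-- The names of the reusable variables along the quantifiers of a formula form a bag sequence that
covers its atoms. -/
theorem exists_bagSeq_atoms {k : ℕ} (hm : m ≤ k + 1) (φ : Fm σ F m) (ρ : Fin m → ℕ) (N : ℕ)
    (hρ : ∀ i, ρ i < N) (L : List (Finset ℕ)) (hL : BagSeq k L) (hρL : Finset.univ.image ρ ∈ L)
    (hN : ∀ B ∈ L, ∀ x ∈ B, x < N) :
    ∃ L' : List (Finset ℕ), BagSeq k L' ∧ (∀ B ∈ L, B ∈ L') ∧ (∀ B ∈ L', ∀ x ∈ B, x < φ.next N) ∧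
      ∀ a ∈ φ.atoms u ρ N, ∃ B ∈ L', ∀ x, a.Mentions x → x ∈ Set.range u ∨ x ∈ B := by
  induction φ generalizing N ρ L with
  | tru => exact ⟨L, hL, fun _ h => h, hN, by simp [atoms]⟩
  | atom a =>
    refine ⟨L, hL, fun _ h => h, hN, fun b hb => ⟨_, hρL, fun x hx => ?_⟩⟩
    obtain rfl := List.mem_singleton.1 hb
    obtain ⟨y, -, rfl⟩ := Atom.mentions_map.1 hx
    rcases y with y | y <;> simp
  | and φ ψ ih1 ih2 =>
    obtain ⟨L1, h1, h1L, h1N, h1a⟩ := ih1 ρ N hρ L hL hρL hN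
    obtain ⟨L2, h2, h2L, h2N, h2a⟩ := ih2 ρ (φ.next N) (fun i => (hρ i).trans_le (φ.le_next N)) L1 h1
      (h1L _ hρL) h1N
    refine ⟨L2, h2, fun B hB => h2L B (h1L B hB), h2N, fun a ha => ?_⟩
    rcases List.mem_append.1 ha with ha | ha
    · obtain ⟨B, hB, h⟩ := h1a a ha
      exact ⟨B, h2L B hB, h⟩
    · exact h2a a ha
  | ex f φ ih =>
    -- The renamed variables form the next bag. Its fresh names are at least `N` and occur in no
    -- earlier bag; the kept ones lie in the image of `ρ`, its predecessor.
    obtain ⟨L', h', hL', hN', ha'⟩ := ih (rebind f ρ N) (N + m) (rebind_lt hρ)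
      (Finset.univ.image (rebind f ρ N) :: L)
      (.cons _ (Finset.univ.image ρ) L hL (List.mem_cons_of_mem _ hρL) (by
        intro x hx Q hQ hxQ
        obtain ⟨i, -, rfl⟩ := Finset.mem_image.1 hx
        cases hf : f i with
        | some j => simp [rebind, hf]
        | none =>
          have := hN Q hQ _ hxQ
          simp [rebind, hf] at this)
        (Finset.card_image_le.trans (by simpa using hm))) (by simp) (by
        intro B hB x hx
        rcases List.mem_cons.1 hB with rfl | hB
        · obtain ⟨i, -, rfl⟩ := Finset.mem_image.1 hx
          exact rebind_lt hρ i
        · exact (hN B hB x hx).trans_le (Nat.le_add_right _ _))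
    exact ⟨L', h', fun B hB => hL' B (List.mem_cons_of_mem _ hB), hN', ha'⟩

end Fm

/-- Restricting the bags to a subtype gives a bag sequence. -/
theorem BagSeq.subtype {V : Type v} {k : ℕ} {L : List (Finset V)} (h : BagSeq k L) (p : V → Prop)
    [DecidablePred p] : BagSeq k (L.map (Finset.subtype p)) := by
  induction h with
  | nil => exact .nil
  | cons B P L hL hP hB hk ih =>
    refine .cons _ (P.subtype p) _ ih ?_ ?_ ?_
    · rcases List.mem_cons.1 hP with rfl | hP
      · exact List.mem_cons.2 (.inl (by ext; simp))
      · exact List.mem_cons_of_mem _ (List.mem_map_of_mem hP)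
    · intro x hx Q hQ hxQ
      obtain ⟨Q, hQ', rfl⟩ := List.mem_map.1 hQ
      rw [Finset.mem_subtype] at *
      exact hB _ hx Q hQ' hxQ
    · rw [Finset.card_subtype]
      exact (Finset.card_filter_le _ _).trans hk

/-- The conjunctive query of treewidth at most `k` that expresses a formula with `k + 1` reusable
variables, in which the free variables are named by `u`. -/
theorem Fm.exists_cq {σ : Schema.{u}} {n k : ℕ} (φ : Fm σ (Fin n) (k + 1)) (u : Fin n → ℕ)
    (hu : ∀ i, u i < n) (hne : ∃ a, φ.HasAtom a)
    (hocc : ∀ i, ∃ a, φ.HasAtom a ∧ ∃ j, a.Mentions (Sum.inl j) ∧ u j = u i) :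
    ∃ q : CQ σ n, q ∈ TW σ n k ∧ q.size = n + φ.size ∧ q.free = u ∧
      ∀ {V : Type v} (A : Set (Atom σ V)) (w : ℕ → V),
        (∃ h : ℕ → V, IsHom q.canonicalDB A h ∧ h ∘ u = w ∘ u) ↔ ∃ d, φ.Sat A (w ∘ u) d := by
  classical
  -- Names below `n` are left to the free variables, the next `k + 1` name the reusable ones, and
  -- quantified variables are named after these.
  set ρ : Fin (k + 1) → ℕ := fun i => n + i with hρ
  have hρN : ∀ i, ρ i < n + (k + 1) := fun i => by simp only [hρ]; omega
  have huN : ∀ i, u i < n + (k + 1) := fun i => (hu i).trans_le (Nat.le_add_right _ _)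
  let q : CQ σ n := ⟨φ.atoms u ρ (n + (k + 1)), by
      obtain ⟨a, ha⟩ := hne
      obtain ⟨ρ', h⟩ := exists_mem_atoms (u := u) ha ρ (n + (k + 1))
      exact List.ne_nil_of_mem h, u, by
      intro i
      obtain ⟨a, ha, j, hj, hji⟩ := hocc i
      obtain ⟨ρ', h⟩ := exists_mem_atoms (u := u) ha ρ (n + (k + 1))
      exact ⟨_, h, Atom.mentions_map.2 ⟨_, hj, hji⟩⟩⟩
  refine ⟨q, ?_, ?_, rfl, ?_⟩
  · obtain ⟨L, hL, -, -, hLa⟩ := φ.exists_bagSeq_atoms (u := u) (k := k) le_rfl ρ (n + (k + 1)) hρN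
      [Finset.univ.image ρ] (.cons _ ∅ _ .nil (by simp) (by simp)
        (Finset.card_image_le.trans (by simp))) (by simp) (by
          intro B hB x hx
          obtain rfl := List.mem_singleton.1 hB
          obtain ⟨i, -, rfl⟩ := Finset.mem_image.1 hx
          exact hρN i)
    have key : ∀ a ∈ q.atoms, ∃ B ∈ L.map (Finset.subtype (· ∈ q.existentialVars)),
        ∀ x : q.existentialVars, a.Mentions x → x ∈ B := by
      intro a ha
      obtain ⟨B, hB, h⟩ := hLa a ha
      refine ⟨_, List.mem_map_of_mem hB, fun x hx => ?_⟩
      rw [Finset.mem_subtype]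
      exact (h x hx).resolve_left x.2.2
    refine (hL.subtype (· ∈ q.existentialVars)).treewidthLE ?_ ?_
    · rintro ⟨x, hx⟩
      obtain ⟨a, ha, hax⟩ := hx.1
      obtain ⟨B, hB, h⟩ := key a ha
      exact ⟨B, hB, h _ hax⟩
    · rintro x y ⟨-, a, ha, hax, hay⟩
      obtain ⟨B, hB, h⟩ := key a ha
      exact ⟨B, hB, h _ hax, h _ hay⟩
  · simp only [CQ.size, q, size_atoms]
  · intro V A w
    constructor
    · rintro ⟨h, hh, hw⟩
      rw [← hw]
      exact ⟨_, φ.sat_of_isHom ρ _ fun a ha => hh a ha⟩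
    · rintro ⟨d, hd⟩
      let g : ℕ → V := fun x => if hx : n ≤ x ∧ x - n < k + 1 then d ⟨x - n, hx.2⟩ else w x
      have gn : ∀ x < n, g x = w x := fun x hx => dif_neg (by omega)
      have g1 : g ∘ u = w ∘ u := funext fun i => gn _ (hu i)
      have g2 : g ∘ ρ = d := by
        funext i
        simp only [Function.comp, hρ, g]
        rw [dif_pos (by omega)]
        congr 1
        exact Fin.ext (by simp)
      obtain ⟨h, hN, hh⟩ := φ.exists_isHom_of_sat (u := u) ρ _ hρN huN g (by rw [g1, g2]; exact hd)
      refine ⟨h, fun a ha => hh h (fun _ _ => rfl) a ha, ?_⟩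
      rw [← g1]
      exact funext fun i => hN _ (huN i)

end QBE

/-! ### The existential pebble game -/

namespace QBE

section Game

variable {σ : Schema.{u}} {n m : ℕ} {E : Type v} {P : Type w}

/-- The tuple `c` of elements of the power `E ^ P` and the tuple `d` of elements of `E` do not
correspond: some atom holds of `c` (and the parameters `a`) in the power, but not of `d` (and `b`). -/
def Violates (A : Set (Atom σ E)) (a : P → Fin n → E) (b : Fin n → E) (c : Fin m → P → E)
    (d : Fin m → E) : Prop :=
  ∃ t : Atom σ (Fin n ⊕ Fin m), (∀ p, t.map (Sum.elim (a p) fun i => c i p) ∈ A) ∧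
    t.map (Sum.elim b d) ∉ A

/-- The positions from which Spoiler wins the existential `m`-pebble game from the power `E ^ P` to `E`
in fewer than `N` rounds. -/
def SpoilerWins (A : Set (Atom σ E)) (a : P → Fin n → E) (b : Fin n → E) :
    ℕ → Set ((Fin m → P → E) × (Fin m → E))
  | 0 => ∅
  | N + 1 => {x | Violates A a b x.1 x.2 ∨ ∃ f c', Fm.Rebinds f x.1 c' ∧
      ∀ d', Fm.Rebinds f x.2 d' → (c', d') ∈ SpoilerWins A a b N}

variable {A : Set (Atom σ E)} {a : P → Fin n → E} {b : Fin n → E}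

theorem spoilerWins_subset_succ (N : ℕ) :
    SpoilerWins (m := m) A a b N ⊆ SpoilerWins A a b (N + 1) := by
  induction N with
  | zero => exact Set.empty_subset _
  | succ N ih =>
    rintro x (h | ⟨f, c', hc', h⟩)
    · exact .inl h
    · exact .inr ⟨f, c', hc', fun d' hd' => ih (h d' hd')⟩

/-- An increasing sequence of subsets of a finite type is constant at some step bounded by the
cardinality. -/
theorem exists_eq_succ_of_monotone {X : Type*} [Fintype X] (s : ℕ → Set X)
    (hs : ∀ N, s N ⊆ s (N + 1)) : ∃ N ≤ Fintype.card X, s (N + 1) = s N := by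
  by_contra! h
  have key : ∀ N ≤ Fintype.card X + 1, N ≤ (s N).ncard := by
    intro N
    induction N with
    | zero => simp
    | succ N ih =>
      intro hN
      have h1 := ih (by omega)
      have h2 : (s N).ncard < (s (N + 1)).ncard :=
        Set.ncard_lt_ncard ((hs N).ssubset_of_ne (h N (by omega)).symm) (Set.toFinite _)
      omega
  have h1 := key _ le_rfl
  have h2 := Set.ncard_le_card (s (Fintype.card X + 1))
  rw [Nat.card_eq_fintype_card] at h2
  omega

/-- A winning strategy of Spoiler yields a formula. -/
theorem exists_fm_of_mem_spoilerWins [Fintype E] {s : ℕ} (hs : ∀ R : σ.Rel, 1 + σ.arity R ≤ s) (N : ℕ)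
    (c : Fin m → P → E) (d : Fin m → E) (h : (c, d) ∈ SpoilerWins A a b N) :
    ∃ φ : Fm σ (Fin n) m, φ.size ≤ s * (Fintype.card E ^ m + 1) ^ N ∧
      (∀ p, φ.Sat A (a p) fun i => c i p) ∧ ¬ φ.Sat A b d := by
  classical
  induction N generalizing c d with
  | zero => exact h.elim
  | succ N ih =>
    rcases h with ⟨t, ht, ht'⟩ | ⟨f, c', hc', h⟩
    · exact ⟨.atom t, (hs t.rel).trans (Nat.le_mul_of_pos_right _ (by positivity)), ht, ht'⟩
    -- Illegal answers `d'` of Duplicator need no refutation and receive the formula `tru`.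
    · have hex : ∀ d', ∃ φ : Fm σ (Fin n) m, φ.size ≤ s * (Fintype.card E ^ m + 1) ^ N ∧
          (∀ p, φ.Sat A (a p) fun i => c' i p) ∧ (Fm.Rebinds f d d' → ¬ φ.Sat A b d') := by
        intro d'
        by_cases hd' : Fm.Rebinds f d d'
        · obtain ⟨φ, h1, h2, h3⟩ := ih c' d' (h d' hd')
          exact ⟨φ, h1, h2, fun _ => h3⟩
        · exact ⟨.tru, Nat.zero_le _, fun _ => trivial, fun h => absurd h hd'⟩
      choose φ h1 h2 h3 using hex
      -- Spoiler's move becomes a quantifier followed by refutations of all answers. Over the power,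
      -- each coordinate of `c'` is a witness; this is why one formula works for all `p`.
      refine ⟨.ex f (Fm.conj (Finset.univ.toList.map φ)), ?_, ?_, ?_⟩
      · refine (Fm.size_conj_le (c := s * (Fintype.card E ^ m + 1) ^ N) (by simpa using h1)).trans ?_
        simp only [List.length_map, Finset.length_toList, Finset.card_univ, Fintype.card_fun,
          Fintype.card_fin]
        rw [pow_succ]
        nlinarith [Nat.zero_le (s * (Fintype.card E ^ m + 1) ^ N)]
      · intro p
        refine ⟨fun i => c' i p, fun i j hij => congrFun (hc' i j hij) p, Fm.sat_conj.2 ?_⟩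
        simp only [List.mem_map, Finset.mem_toList, Finset.mem_univ, true_and]
        rintro _ ⟨d', rfl⟩
        exact h2 d' p
      · rintro ⟨d', hd', hsat⟩
        exact h3 d' hd' (Fm.sat_conj.1 hsat _ (List.mem_map_of_mem (by simp)))

/-- Enumerating a set of at most `m` elements by `Fin m`, with gaps. -/
theorem exists_enumeration {V : Type*} (B : Finset V) (hB : B.card ≤ m) :
    ∃ e : Fin m → Option V, (∀ x ∈ B, ∃ i, e i = some x) ∧ ∀ i x, e i = some x → x ∈ B := by
  classical
  refine ⟨fun i => if h : (i : ℕ) < B.card then some (B.equivFin.symm ⟨i, h⟩) else none, ?_, ?_⟩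
  · intro x hx
    refine ⟨⟨B.equivFin ⟨x, hx⟩, (B.equivFin ⟨x, hx⟩).2.trans_le hB⟩, ?_⟩
    simp
  · intro i x h
    dsimp only at h
    split_ifs at h with hi
    · cases h; exact Subtype.prop _

/-- If Duplicator survives forever, then every assignment in the power of the vertices of a bag sequence
is followed by an assignment in `E` such that each bag is in a surviving position. -/
theorem exists_assignment_of_bagSeq {V : Type*} {k : ℕ} {L : List (Finset V)} (hL : BagSeq k L)
    (hk : k + 1 ≤ m) [Nonempty (P → E)] [Nonempty E] (W : Set ((Fin m → P → E) × (Fin m → E)))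
    (hW : ∀ c, ∃ d, (c, d) ∈ W)
    (hW' : ∀ c d, (c, d) ∈ W → ∀ f c', Fm.Rebinds f c c' → ∃ d', Fm.Rebinds f d d' ∧ (c', d') ∈ W)
    (α : V → P → E) :
    ∃ g : V → E, ∀ B ∈ ∅ :: L, ∃ c d, (c, d) ∈ W ∧ ∀ x ∈ B, ∃ i, c i = α x ∧ d i = g x := by
  classical
  obtain ⟨α₀⟩ := ‹Nonempty (P → E)›
  obtain ⟨e₀⟩ := ‹Nonempty E›
  have : Nonempty (Fin m) := ⟨⟨0, by omega⟩⟩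
  induction hL with
  | nil =>
    obtain ⟨d, hd⟩ := hW fun _ => α₀
    refine ⟨fun _ => e₀, fun B hB => ⟨_, d, hd, fun x hx => ?_⟩⟩
    simp only [List.mem_singleton] at hB
    subst hB
    simp at hx
  | cons B Q L hL hQ hB hBk ih =>
    obtain ⟨g, hg⟩ := ih
    obtain ⟨c, d, hcd, hQcd⟩ := hg Q hQ
    obtain ⟨e, he, he'⟩ := exists_enumeration (m := m) B (hBk.trans hk)
    choose! ι hι hι' using hQcd
    choose! κ hκ using he
    -- Pebbles on vertices shared with the predecessor bag `Q` stay in place, all others are lifted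
    -- and set anew. Unused pebbles go to `α₀`.
    let f : Fin m → Option (Fin m) := fun i =>
      (e i).bind fun x => if x ∈ Q then some (ι x) else none
    let c' : Fin m → P → E := fun i => (e i).elim α₀ α
    obtain ⟨d', hd', hcd'⟩ := hW' c d hcd f c' (by
      intro i j hij
      simp only [f, Option.bind_eq_some_iff] at hij
      obtain ⟨x, hx, hxj⟩ := hij
      split_ifs at hxj with hxQ
      cases hxj
      simp [c', hx, hι x hxQ])
    refine ⟨fun x => if ∃ Q ∈ L, x ∈ Q then g x else d' (κ x), fun B' hB' => ?_⟩
    rw [List.mem_cons, List.mem_cons] at hB'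
    rcases hB' with rfl | rfl | hB'
    · exact ⟨c, d, hcd, by simp⟩
    · refine ⟨c', d', hcd', fun x hx => ⟨κ x, by simp [c', hκ x hx], ?_⟩⟩
      dsimp only
      split_ifs with hxL
      · obtain ⟨Q', hQ', hxQ'⟩ := hxL
        have hxQ : x ∈ Q := hB x hx Q' hQ' hxQ'
        rw [hd' (κ x) (ι x) (by simp [f, hκ x hx, hxQ]), hι' x hxQ]
      · rfl
    · obtain ⟨c1, d1, hcd1, h⟩ := hg B' (List.mem_cons_of_mem _ hB')
      refine ⟨c1, d1, hcd1, fun x hx => ?_⟩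
      dsimp only
      rw [if_pos ⟨B', hB', hx⟩]
      exact h x hx

end Game

namespace CQ

variable {σ : Schema.{u}} {n k : ℕ}

/-- The existentially quantified variables of each atom of a query of treewidth at most `k` lie in
a common bag. -/
theorem exists_bagSeq {q : CQ σ n} (hq : q ∈ TW σ n k) :
    ∃ L : List (Finset q.existentialVars), BagSeq k L ∧
      ∀ a ∈ q.atoms, ∃ B ∈ ∅ :: L, ∀ x : q.existentialVars, a.Mentions x → x ∈ B := by
  obtain ⟨L, hL, hv, he⟩ := BagSeq.exists_of_treewidthLE hq
  refine ⟨L, hL, fun a ha => hL.exists_bag_of_clique _ fun x y hx hy => ?_⟩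
  by_cases hxy : x = y
  · subst hxy
    obtain ⟨B, hB, h⟩ := hv x
    exact ⟨B, hB, h, h⟩
  · exact he x y ⟨hxy, a, ha, hx, hy⟩

open Classical in
/-- Replacing the free variables of a query by their indices and the other ones by the indices `ι`. -/
noncomputable def term {m : ℕ} (q : CQ σ n) (ι : q.existentialVars → Fin m) (i₀ : Fin m) (x : ℕ) :
    Fin n ⊕ Fin m :=
  if h : ∃ i, q.free i = x then .inl h.choose
  else if h' : x ∈ q.existentialVars then .inr (ι ⟨x, h'⟩) else .inr i₀

theorem elim_term {m : ℕ} {q : CQ σ n} {ι : q.existentialVars → Fin m} {i₀ : Fin m} {E : Type*}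
    {e : Fin n → E} {d : Fin m → E} {h : ℕ → E} {a : Atom σ ℕ} (ha : a ∈ q.atoms)
    (he : ∀ i, e i = h (q.free i)) (hd : ∀ x : q.existentialVars, a.Mentions x → d (ι x) = h x) :
    (a.map (q.term ι i₀)).map (Sum.elim e d) = a.map h := by
  rw [Atom.map_map]
  refine Atom.map_congr fun x hx => ?_
  unfold term
  by_cases hf : ∃ i, q.free i = x
  · simp only [Function.comp, dif_pos hf, Sum.elim_inl]
    rw [he, hf.choose_spec]
  · have hx' : x ∈ q.existentialVars := ⟨⟨a, ha, hx⟩, fun ⟨i, hi⟩ => hf ⟨i, hi⟩⟩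
    simp only [Function.comp, dif_neg hf, dif_pos hx', Sum.elim_inr]
    exact hd ⟨x, hx'⟩ hx

theorem term_free {m : ℕ} {q : CQ σ n} {ι : q.existentialVars → Fin m} {i₀ : Fin m} (i : Fin n) :
    ∃ j, q.free j = q.free i ∧ q.term ι i₀ (q.free i) = .inl j := by
  have hf : ∃ j, q.free j = q.free i := ⟨i, rfl⟩
  exact ⟨hf.choose, hf.choose_spec, by unfold term; rw [dif_pos hf]⟩

/-- If the query `q` of treewidth at most `k` holds of all `a p` but not of `b`, then Spoiler wins the
existential `(k + 1)`-pebble game, and a formula of bounded size separates the `a p` from `b`. -/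
theorem exists_fm_of_not_isHom {E : Type v} [Fintype E] {P : Type w} [Fintype P] {q : CQ σ n}
    (hq : q ∈ TW σ n k) {A : Set (Atom σ E)} {a : P → Fin n → E} {b : Fin n → E} {s : ℕ}
    (hs : ∀ R : σ.Rel, 1 + σ.arity R ≤ s)
    (ha : ∀ p, ∃ h : ℕ → E, IsHom q.canonicalDB A h ∧ a p = fun i => h (q.free i))
    (hb : ¬ ∃ h : ℕ → E, IsHom q.canonicalDB A h ∧ b = fun i => h (q.free i))
    (hpat : ∀ i j, q.free i = q.free j → b i = b j) :
    ∃ φ : Fm σ (Fin n) (k + 1),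
      φ.size ≤ s * (Fintype.card E ^ (k + 1) + 1) ^
        ((Fintype.card E ^ Fintype.card P) ^ (k + 1) * Fintype.card E ^ (k + 1) + 1) ∧
      (∀ p d, φ.Sat A (a p) d) ∧ ∀ d, ¬ φ.Sat A b d := by
  classical
  choose h hh hah using ha
  have : Nonempty (P → E) := ⟨fun p => h p 0⟩
  -- At this stage Spoiler's winning region is a fixed point, so from any position in its complement
  -- Duplicator can answer every move and remain in the complement.
  obtain ⟨N, hN, hfix⟩ := exists_eq_succ_of_monotone (SpoilerWins (m := k + 1) A a b)
    spoilerWins_subset_succ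
  simp only [Fintype.card_prod, Fintype.card_fun, Fintype.card_fin] at hN
  -- Either Spoiler has an opening placement that beats every answer, which gives the formula, or
  -- the surviving positions assemble to a homomorphism of `q` that yields `b`, contradicting `hb`.
  by_cases hwin : ∃ c, ∀ d, (c, d) ∈ SpoilerWins (m := k + 1) A a b N
  · obtain ⟨c, hc⟩ := hwin
    have hall : ∀ d : Fin (k + 1) → E, ∃ φ : Fm σ (Fin n) (k + 1),
      φ.size ≤ s * (Fintype.card E ^ (k + 1) + 1) ^ N ∧
        (∀ p, φ.Sat A (a p) fun i => c i p) ∧ ¬ φ.Sat A b d := fun d =>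
      exists_fm_of_mem_spoilerWins hs N c d (hc d)
    choose φ h1 h2 h3 using hall
    refine ⟨.ex (fun _ => none) (Fm.conj (Finset.univ.toList.map φ)), ?_, ?_, ?_⟩
    · refine (Fm.size_conj_le (c := s * (Fintype.card E ^ (k + 1) + 1) ^ N) (by simpa using h1)).trans ?_
      simp only [List.length_map, Finset.length_toList, Finset.card_univ, Fintype.card_fun,
        Fintype.card_fin]
      calc Fintype.card E ^ (k + 1) * (s * (Fintype.card E ^ (k + 1) + 1) ^ N)
          ≤ s * (Fintype.card E ^ (k + 1) + 1) ^ (N + 1) := by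
            rw [pow_succ _ N]
            nlinarith [Nat.zero_le (s * (Fintype.card E ^ (k + 1) + 1) ^ N)]
        _ ≤ _ := Nat.mul_le_mul_left _ (Nat.pow_le_pow_right (Nat.succ_pos _) (by omega))
    · intro p d
      refine ⟨fun i => c i p, fun i j hij => by simp at hij, Fm.sat_conj.2 ?_⟩
      simp only [List.mem_map, Finset.mem_toList, Finset.mem_univ, true_and]
      rintro _ ⟨d', rfl⟩
      exact h2 d' p
    · rintro d ⟨d', -, hsat⟩
      exact h3 d' (Fm.sat_conj.1 hsat _ (List.mem_map_of_mem (by simp)))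
  · push Not at hwin
    exfalso
    apply hb
    have : Nonempty E := by
      obtain ⟨d, -⟩ := hwin fun _ p => h p 0
      exact ⟨d 0⟩
    obtain ⟨L, hL, hLa⟩ := exists_bagSeq hq
    obtain ⟨g, hg⟩ := exists_assignment_of_bagSeq (m := k + 1) hL le_rfl
      (SpoilerWins (m := k + 1) A a b N)ᶜ hwin (by
        intro c d hcd f c' hf
        by_contra! hno
        refine hcd ?_
        rw [← hfix]
        exact .inr ⟨f, c', hf, fun d' hd' => not_not.1 (hno d' hd')⟩) (fun x p => h p x)
    obtain ⟨e₀⟩ := ‹Nonempty E›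
    let G : ℕ → E := fun x => if hx : ∃ i, q.free i = x then b hx.choose
      else if hx : x ∈ q.existentialVars then g ⟨x, hx⟩ else e₀
    have hGfree : ∀ i, b i = G (q.free i) := by
      intro i
      have hx : ∃ j, q.free j = q.free i := ⟨i, rfl⟩
      simp only [G, dif_pos hx]
      exact hpat _ _ hx.choose_spec.symm
    have hGex : ∀ x : q.existentialVars, G x = g x := by
      rintro ⟨x, hx⟩
      have : ¬ ∃ i, q.free i = x := fun ⟨i, hi⟩ => hx.2 ⟨i, hi⟩
      simp only [G, dif_neg this, dif_pos hx]
    refine ⟨G, fun t ht => ?_, funext hGfree⟩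
    obtain ⟨B, hB, htB⟩ := hLa t ht
    obtain ⟨c, d, hcd, hBcd⟩ := hg B hB
    choose! ι hι hι' using hBcd
    have hnv : ¬ Violates A a b c d := fun hv => hcd (by rw [← hfix]; exact .inl hv)
    by_contra hnot
    refine hnv ⟨t.map (q.term ι 0), fun p => ?_, ?_⟩
    · rw [elim_term (h := h p) ht (fun i => by rw [hah p]) (fun x hx => by rw [hι x (htB x hx)])]
      exact hh p t ht
    · rwa [elim_term (h := G) ht hGfree (fun x hx => by rw [hι' x (htB x hx), hGex])]

/-- Each atom of a query of treewidth at most `k` gives a formula implied by the query. -/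
theorem exists_fm_of_mem_atoms {q : CQ σ n} (hq : q ∈ TW σ n k) {t : Atom σ ℕ} (ht : t ∈ q.atoms) :
    ∃ φ : Fm σ (Fin n) (k + 1), φ.size = t.size ∧
      (∀ i, t.Mentions (q.free i) → ∃ j, q.free j = q.free i ∧ ∃ a, φ.HasAtom a ∧ a.Mentions (.inl j)) ∧
      (∃ a, φ.HasAtom a) ∧
      ∀ {E : Type v} (A : Set (Atom σ E)) (h : ℕ → E), IsHom q.canonicalDB A h →
        ∀ d, φ.Sat A (fun i => h (q.free i)) d := by
  classical
  obtain ⟨L, hL, hLa⟩ := exists_bagSeq hq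
  obtain ⟨B, hB, htB⟩ := hLa t ht
  have hBk : B.card ≤ k + 1 := by
    rcases List.mem_cons.1 hB with rfl | hB
    · simp
    · exact hL.card_le B hB
  obtain ⟨e, he, -⟩ := exists_enumeration B hBk
  choose! ι hι using he
  refine ⟨.ex (fun _ => none) (.atom (t.map (q.term ι 0))), rfl, ?_, ⟨_, rfl⟩, ?_⟩
  · intro i hi
    obtain ⟨j, hj, hj'⟩ := term_free (q := q) (ι := ι) (i₀ := 0) i
    exact ⟨j, hj, _, rfl, Atom.mentions_map.2 ⟨_, hi, hj'⟩⟩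
  · intro E A h hh d
    refine ⟨fun i => (e i).elim (h 0) fun x => h x, fun i j hij => by simp at hij, ?_⟩
    show (t.map (q.term ι 0)).map _ ∈ A
    rw [elim_term (h := h) ht (fun _ => rfl) (fun x hx => by simp [hι x (htB x hx)])]
    exact hh t ht

end CQ

end QBE

/-! ### The double exponential upper bound -/

namespace QBE

section Induced

variable {σ : Schema.{u}} {C : Type v}

theorem exists_fintype_elements (D : Database σ C) :
    ∃ _ : Fintype (elements (D : Set (Atom σ C))),
      Fintype.card (elements (D : Set (Atom σ C))) ≤ ∑ a ∈ D, a.size := by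
  let f : (Σ a : D, Fin (σ.arity a.1.rel)) → elements (D : Set (Atom σ C)) := fun x =>
    ⟨x.1.1.args x.2, x.1.1, x.1.2, x.2, rfl⟩
  have hf : Function.Surjective f := by
    rintro ⟨x, a, ha, i, rfl⟩
    exact ⟨⟨⟨a, ha⟩, i⟩, rfl⟩
  have := Finite.of_surjective f hf
  refine ⟨Fintype.ofFinite _, ?_⟩
  let _ := Fintype.ofFinite (elements (D : Set (Atom σ C)))
  refine (Fintype.card_le_of_surjective f hf).trans ?_
  rw [Fintype.card_sigma, ← Finset.sum_coe_sort D]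
  refine Finset.sum_le_sum fun a _ => ?_
  simp [Atom.size]

/-- The atoms of `D` as atoms over the elements of `D`. -/
def inducedAtoms (D : Database σ C) : Set (Atom σ (elements (D : Set (Atom σ C)))) :=
  {a | a.map Subtype.val ∈ D}

/-- The game needs a finite domain, while `C` may be infinite. Variables outside the atoms may have
values outside the database; these are redirected to an element, which exists because `q` has an
atom and arities are positive. -/
theorem CQ.mem_eval_iff {n : ℕ} {q : CQ σ n} {D : Database σ C} {t : Fin n → C} :
    t ∈ q.eval D ↔ ∃ t' : Fin n → elements (D : Set (Atom σ C)), (t = fun i => (t' i : C)) ∧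
      ∃ h : ℕ → elements (D : Set (Atom σ C)),
        IsHom q.canonicalDB (inducedAtoms D) h ∧ t' = fun i => h (q.free i) := by
  classical
  constructor
  · rintro ⟨h, hh, rfl⟩
    have hel : ∀ a ∈ q.atoms, ∀ x, a.Mentions x → h x ∈ elements (D : Set (Atom σ C)) :=
      fun a ha x hx => ⟨_, hh a ha, Atom.mentions_map.2 ⟨x, hx, rfl⟩⟩
    obtain ⟨e₀⟩ : Nonempty (elements (D : Set (Atom σ C))) := by
      obtain ⟨a, ha⟩ := List.exists_mem_of_ne_nil _ q.atoms_ne_nil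
      exact ⟨⟨_, hel a ha _ ⟨⟨0, σ.arity_pos _⟩, rfl⟩⟩⟩
    let h' : ℕ → elements (D : Set (Atom σ C)) := fun x =>
      if hx : h x ∈ elements (D : Set (Atom σ C)) then ⟨h x, hx⟩ else e₀
    have hval : ∀ a ∈ q.atoms, ∀ x, a.Mentions x → (h' x : C) = h x := by
      intro a ha x hx
      simp only [h', dif_pos (hel a ha x hx)]
    refine ⟨fun i => h' (q.free i), ?_, h', fun a ha => ?_, rfl⟩
    · funext i
      obtain ⟨a, ha, hi⟩ := q.free_mem i
      exact (hval a ha _ hi).symm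
    · show (a.map h').map Subtype.val ∈ D
      rw [Atom.map_map, Atom.map_congr (f := Subtype.val ∘ h') (g := h) (fun x hx => hval a ha x hx)]
      exact hh a ha
  · rintro ⟨_, rfl, h, hh, rfl⟩
    exact ⟨fun x => h x, fun a ha => hh a ha, rfl⟩

end Induced

/-- Here `e` counts the elements, `n` is the arity, `r` the number of positive tuples and `m` the
number of reusable variables. The summands are the free variables, `e ^ n` separating formulas, `n`
atoms for the free variables and one further atom. -/
theorem size_bound {e n r s m : ℕ} (he : e ≤ s) (hn : n ≤ s) (hr : r ≤ s) :
    n + (e ^ n * (s * (e ^ m + 1) ^ ((e ^ r) ^ m * e ^ m + 1)) + (n * s + s)) ≤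
      2 ^ 2 ^ (s ^ 2 * m + 2 * (s * m) + s ^ 2 + 2 * s + 4) := by
  have hs2 : s ≤ 2 ^ s := Nat.lt_two_pow_self.le
  have he2 : e ≤ 2 ^ s := he.trans hs2
  have pow1 : ∀ j, e ^ j ≤ 2 ^ (s * j) := fun j => by
    rw [pow_mul]; exact Nat.pow_le_pow_left he2 j
  have h2 : e ^ m + 1 ≤ 2 ^ (s * m + 1) := by
    have := pow1 m
    have h1 : 1 ≤ 2 ^ (s * m) := Nat.one_le_two_pow
    rw [pow_succ]; omega
  set Y := 2 ^ (s * s * m + s * m + 1) with hY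
  have h3 : (e ^ r) ^ m * e ^ m + 1 ≤ Y := by
    have h1 : (e ^ r) ^ m ≤ 2 ^ (s * s * m) := by
      rw [← pow_mul]
      refine (pow1 _).trans (Nat.pow_le_pow_right (by norm_num) ?_)
      rw [mul_assoc]
      exact Nat.mul_le_mul_left _ (Nat.mul_le_mul_right _ hr)
    have h2 := Nat.mul_le_mul h1 (pow1 m)
    rw [← pow_add] at h2
    have h1 : 1 ≤ 2 ^ (s * s * m + s * m) := Nat.one_le_two_pow
    rw [hY, pow_succ]; omega
  have hY1 : 1 ≤ Y := Nat.one_le_two_pow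
  set T := s * s + s + (s * m + 1) * Y + s with hT
  have h4 : e ^ n * (s * (e ^ m + 1) ^ ((e ^ r) ^ m * e ^ m + 1)) ≤ 2 ^ T := by
    calc e ^ n * (s * (e ^ m + 1) ^ ((e ^ r) ^ m * e ^ m + 1))
        ≤ 2 ^ (s * s) * (2 ^ s * (2 ^ (s * m + 1)) ^ Y) := by
          refine Nat.mul_le_mul ((pow1 n).trans (Nat.pow_le_pow_right (by norm_num)
            (Nat.mul_le_mul_left _ hn))) (Nat.mul_le_mul hs2 ?_)
          exact (Nat.pow_le_pow_left h2 _).trans (Nat.pow_le_pow_right (by positivity) h3)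
      _ = 2 ^ (s * s + (s + (s * m + 1) * Y)) := by rw [← pow_mul, ← pow_add, ← pow_add]
      _ ≤ 2 ^ T := Nat.pow_le_pow_right (by norm_num) (by omega)
  have h5 : s ≤ 2 ^ T := hs2.trans (Nat.pow_le_pow_right (by norm_num) (by omega))
  have h6 : n * s ≤ 2 ^ T := by
    calc n * s ≤ 2 ^ s * 2 ^ s := Nat.mul_le_mul (hn.trans hs2) hs2
      _ = 2 ^ (s + s) := by rw [pow_add]
      _ ≤ 2 ^ T := Nat.pow_le_pow_right (by norm_num) (by omega)
  have h7 : T + 2 ≤ 2 ^ (s ^ 2 * m + 2 * (s * m) + s ^ 2 + 2 * s + 4) := by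
    calc T + 2 ≤ (s * m + s * s + 2 * s + 3) * Y := by nlinarith
      _ ≤ 2 ^ (s * m + s * s + 2 * s + 3) * Y := Nat.mul_le_mul_right _ Nat.lt_two_pow_self.le
      _ = 2 ^ (s ^ 2 * m + 2 * (s * m) + s ^ 2 + 2 * s + 4) := by rw [hY, ← pow_add]; ring_nf
  calc _ ≤ 2 ^ T * 4 := by omega
    _ = 2 ^ (T + 2) := by rw [pow_add _ T]; norm_num
    _ ≤ _ := Nat.pow_le_pow_right (by norm_num) h7

/-- A query of treewidth at most `k` that holds of the tuples of a relation can be replaced by one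
of double exponential size that holds of these tuples and implies the given one. -/
theorem exists_small_cq {k : ℕ} (I : DefinabilityInput.{u, v}) {q₀ : CQ I.σ I.arity}
    (hq₀ : q₀ ∈ TW I.σ I.arity k) (hpos : (I.pos : Set (Fin I.arity → I.C)) ⊆ q₀.eval I.D) :
    ∃ q ∈ TW I.σ I.arity k, (I.pos : Set (Fin I.arity → I.C)) ⊆ q.eval I.D ∧
      q.eval I.D ⊆ q₀.eval I.D ∧
      q.size ≤ 2 ^ 2 ^ (I.size ^ 2 * (k + 1) + 2 * (I.size * (k + 1)) + I.size ^ 2 + 2 * I.size + 4) := by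
  classical
  obtain ⟨σ, C, D, n, pos, pos_over⟩ := I
  set s := DefinabilityInput.size ⟨σ, C, D, n, pos, pos_over⟩ with hs
  dsimp only at *
  have hsize : s = (σ.size + ∑ a ∈ D, a.size) + (1 + pos.card) * (1 + n) := rfl
  rw [show (1 + pos.card) * (1 + n) = 1 + n + pos.card + pos.card * n by ring] at hsize
  have hn : n ≤ s := by omega
  have hcardpos : pos.card ≤ s := by omega
  have har : ∀ R : σ.Rel, 1 + σ.arity R ≤ s := by
    intro R
    have : 1 + σ.arity R ≤ σ.size :=
      Finset.single_le_sum (f := fun R => 1 + σ.arity R) (fun _ _ => Nat.zero_le _) (Finset.mem_univ R)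
    omega
  obtain ⟨_, hE⟩ := exists_fintype_elements D
  set A := inducedAtoms D
  have hEs : Fintype.card (elements (D : Set (Atom σ C))) ≤ s := by omega
  have hmem : ∀ p : pos, ∃ t' : Fin n → elements (D : Set (Atom σ C)), (p.1 = fun i => (t' i : C)) ∧
      ∃ h : ℕ → elements (D : Set (Atom σ C)),
        IsHom q₀.canonicalDB A h ∧ t' = fun i => h (q₀.free i) :=
    fun p => CQ.mem_eval_iff.1 (hpos p.2)
  choose a ha ha' using hmem
  set S₁ := s * (Fintype.card (elements (D : Set (Atom σ C))) ^ (k + 1) + 1) ^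
    ((Fintype.card (elements (D : Set (Atom σ C))) ^ pos.card) ^ (k + 1) *
      Fintype.card (elements (D : Set (Atom σ C))) ^ (k + 1) + 1) with hS₁
  -- Tuples `b` that break an equality forced by repeated free variables need no formula: the new
  -- query repeats its free variables in the same way.
  have hsep : ∀ b : Fin n → elements (D : Set (Atom σ C)), ∃ φ : Fm σ (Fin n) (k + 1), φ.size ≤ S₁ ∧
      (∀ p d, φ.Sat A (a p) d) ∧
      ((¬ ∃ h, IsHom q₀.canonicalDB A h ∧ b = fun i => h (q₀.free i)) →
        (∀ i j, q₀.free i = q₀.free j → b i = b j) → ∀ d, ¬ φ.Sat A b d) := by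
    intro b
    by_cases hb : (¬ ∃ h, IsHom q₀.canonicalDB A h ∧ b = fun i => h (q₀.free i)) ∧
        (∀ i j, q₀.free i = q₀.free j → b i = b j)
    · obtain ⟨φ, h1, h2, h3⟩ := CQ.exists_fm_of_not_isHom hq₀ har ha' hb.1 hb.2
      rw [Fintype.card_coe] at h1
      exact ⟨φ, h1, h2, fun _ _ => h3⟩
    · exact ⟨.tru, Nat.zero_le _, fun _ _ => trivial, fun h1 h2 => absurd ⟨h1, h2⟩ hb⟩
  choose φ hφsize hφpos hφneg using hsep
  -- The separating formulas may miss free variables or have no atom at all. The `ψ i` make each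
  -- free variable occur, and `χ` contributes an atom even in arity 0.
  choose t ht hti using q₀.free_mem
  have hsafe := fun i => CQ.exists_fm_of_mem_atoms hq₀ (ht i)
  choose ψ hψsize hψocc _ hψpos using hsafe
  obtain ⟨t₀, ht₀⟩ := List.exists_mem_of_ne_nil _ q₀.atoms_ne_nil
  obtain ⟨χ, hχsize, -, hχne, hχpos⟩ := CQ.exists_fm_of_mem_atoms hq₀ ht₀
  -- Each free variable is named by the first index at which it occurs in `q₀.free`.
  have hsInf : ∀ i, ∃ j : Fin n, (j : ℕ) = sInf {m : ℕ | ∃ j : Fin n, (j : ℕ) = m ∧ q₀.free j = q₀.free i} ∧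
      q₀.free j = q₀.free i := fun i =>
    Nat.sInf_mem (s := {m : ℕ | ∃ j : Fin n, (j : ℕ) = m ∧ q₀.free j = q₀.free i}) ⟨i, i, rfl, rfl⟩
  set u : Fin n → ℕ := fun i => sInf {m : ℕ | ∃ j : Fin n, (j : ℕ) = m ∧ q₀.free j = q₀.free i} with hu
  have hufree : ∀ i j, q₀.free i = q₀.free j → u i = u j := fun i j hij => by simp only [hu, hij]
  let Φ : Fm σ (Fin n) (k + 1) := .and (.conj (Finset.univ.toList.map φ))
    (.and (.conj (Finset.univ.toList.map ψ)) χ)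
  obtain ⟨q, hqTW, hqsize, hqfree, hq⟩ := Φ.exists_cq u (fun i => by
      obtain ⟨j, hj, -⟩ := hsInf i
      rw [hu]; dsimp only; rw [← hj]; exact j.2)
    (by obtain ⟨a, ha⟩ := hχne; exact ⟨a, .inr (.inr ha)⟩)
    (fun i => by
      obtain ⟨j, hj, a, ha, haj⟩ := hψocc i i (hti i)
      refine ⟨a, .inr (.inl (Fm.hasAtom_conj.2 ⟨ψ i, List.mem_map_of_mem (by simp), ha⟩)), j, haj,
        hufree _ _ hj⟩)
  refine ⟨q, hqTW, ?_, ?_, ?_⟩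
  · intro p hp
    rw [CQ.mem_eval_iff]
    refine ⟨_, ha ⟨p, hp⟩, ?_⟩
    obtain ⟨h, hh, hah⟩ := ha' ⟨p, hp⟩
    let w : ℕ → elements (D : Set (Atom σ C)) := fun m => if hm : m < n then h (q₀.free ⟨m, hm⟩) else h 0
    have hw : w ∘ u = a ⟨p, hp⟩ := by
      funext i
      obtain ⟨j, hj, hji⟩ := hsInf i
      have : u i = j := hj.symm
      simp only [Function.comp, w, this, hah]
      rw [dif_pos j.2]
      exact congrArg h hji
    obtain ⟨g, hg, hgw⟩ := (hq A w).2 ⟨fun _ => h 0, by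
      rw [hw]
      refine ⟨Fm.sat_conj.2 ?_, Fm.sat_conj.2 ?_, ?_⟩
      · simp only [List.mem_map, Finset.mem_toList, Finset.mem_univ, true_and]
        rintro _ ⟨b, rfl⟩
        exact hφpos b _ _
      · simp only [List.mem_map, Finset.mem_toList, Finset.mem_univ, true_and]
        rintro _ ⟨i, rfl⟩
        rw [hah]
        exact hψpos i A h hh _
      · rw [hah]
        exact hχpos A h hh _⟩
    refine ⟨g, hg, ?_⟩
    rw [hqfree]
    exact hw.symm.trans hgw.symm
  · intro t ht
    obtain ⟨t', rfl, h, hh, rfl⟩ := CQ.mem_eval_iff.1 ht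
    rw [hqfree]
    obtain ⟨d, hd⟩ := (hq A h).1 ⟨h, hh, rfl⟩
    refine CQ.mem_eval_iff.2 ⟨fun i => h (u i), rfl, ?_⟩
    by_contra hno
    exact hφneg _ hno (fun i j hij => congrArg h (hufree i j hij)) d
      (Fm.sat_conj.1 hd.1 _ (List.mem_map_of_mem (by simp)))
  · rw [hqsize]
    refine le_trans ?_ (size_bound (m := k + 1) hEs hn hcardpos)
    refine Nat.add_le_add_left (Nat.add_le_add ?_ (Nat.add_le_add ?_ ?_)) _
    · refine (Fm.size_conj_le (c := S₁) (by simpa using hφsize)).trans ?_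
      simp only [List.length_map, Finset.length_toList, Finset.card_univ, Fintype.card_fun,
        Fintype.card_fin]
      exact le_rfl
    · refine (Fm.size_conj_le (c := s) ?_).trans ?_
      · simp only [List.mem_map, Finset.mem_toList, Finset.mem_univ, true_and]
        rintro _ ⟨i, rfl⟩
        rw [hψsize]
        exact har _
      · simp
    · rw [hχsize]
      exact har _

theorem exists_definition_le (k : ℕ) :
    ∃ p : Polynomial ℕ, ∀ I : DefinabilityInput.{u, v}, (I.definitions k).Nonempty →
      ∃ q ∈ I.definitions k, q.size ≤ 2 ^ (2 ^ p.eval I.size) := by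
  refine ⟨.X ^ 2 * .C (k + 1) + 2 * (.X * .C (k + 1)) + .X ^ 2 + 2 * .X + 4, fun I ⟨q₀, hq₀, hev⟩ => ?_⟩
  obtain ⟨q, hq, h1, h2, h3⟩ := exists_small_cq I hq₀ hev.ge
  refine ⟨q, ⟨hq, (h2.trans hev.le).antisymm h1⟩, ?_⟩
  simpa using h3

theorem exists_explanation_le (k : ℕ) :
    ∃ p : Polynomial ℕ, ∀ I : QBEInput.{u, v}, (I.explanations k).Nonempty →
      ∃ q ∈ I.explanations k, q.size ≤ 2 ^ (2 ^ p.eval I.size) := by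
  refine ⟨.X ^ 2 * .C (k + 1) + 2 * (.X * .C (k + 1)) + .X ^ 2 + 2 * .X + 4,
    fun I ⟨q₀, hq₀, hev, hneg⟩ => ?_⟩
  obtain ⟨q, hq, h1, h2, h3⟩ := exists_small_cq I.toDefinabilityInput hq₀ hev
  refine ⟨q, ⟨hq, h1, Set.subset_empty_iff.1 ((Set.inter_subset_inter_left _ h2).trans hneg.le)⟩, ?_⟩
  have hle : I.toDefinabilityInput.size ≤ I.size := Nat.le_add_right _ _
  refine h3.trans (Nat.pow_le_pow_right (by norm_num) (Nat.pow_le_pow_right (by norm_num) ?_))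
  simp only [Polynomial.eval_add, Polynomial.eval_mul, Polynomial.eval_pow, Polynomial.eval_X,
    Polynomial.eval_C, Polynomial.eval_ofNat]
  gcongr

end QBE

/-! ### The lower bound: databases with small relations that only deep trees define -/

namespace QBE

/-- The relation symbols: `start` and `mark` are unary, the `edge j` are binary. -/
inductive TreeRel (K : ℕ)
  | start : TreeRel K
  | mark : TreeRel K
  | edge (j : Fin K) : TreeRel K

/-- `TreeRel K` as a sum type. -/
def treeRelEquiv (K : ℕ) : TreeRel K ≃ (Unit ⊕ Unit) ⊕ Fin K where
  toFun
    | .start => .inl (.inl ())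
    | .mark => .inl (.inr ())
    | .edge j => .inr j
  invFun
    | .inl (.inl _) => .start
    | .inl (.inr _) => .mark
    | .inr j => .edge j
  left_inv := by rintro (_ | _ | _) <;> rfl
  right_inv := by rintro ((_ | _) | _) <;> rfl

instance (K : ℕ) : Fintype (TreeRel K) := Fintype.ofEquiv _ (treeRelEquiv K).symm

/-- The schema with the symbols `TreeRel K`. -/
def treeSchema (K : ℕ) : Schema.{0} where
  Rel := TreeRel K
  arity
    | .start => 1
    | .mark => 1
    | .edge _ => 2
  arity_pos := by rintro (_ | _ | _) <;> exact Nat.succ_pos _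

/-- The constants: positions `c` on cycles of length `p + 1`, positions on a structure that records the
last edge label, a constant `top` of which everything holds, and constants `defect j`, where `defect j`
stands for a node without a good `j`-child. -/
inductive TreeElt (m K : ℕ)
  | cyc (p c : Fin m) : TreeElt m K
  | lab (o : Option (Fin K)) : TreeElt m K
  | top : TreeElt m K
  | defect (j : Fin K) : TreeElt m K

namespace TreeElt

variable {m K : ℕ}

def toSum : TreeElt m K → (Fin m × Fin m) ⊕ Option (Fin K) ⊕ Option (Fin K)
  | cyc p c => .inl (p, c)
  | lab o => .inr (.inl o)
  | top => .inr (.inr none)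
  | defect j => .inr (.inr (some j))

theorem toSum_injective : Function.Injective (toSum (m := m) (K := K)) := by
  rintro (_ | _ | _ | _) (_ | _ | _ | _) h <;> simp_all [toSum]

noncomputable instance : Fintype (TreeElt m K) := Fintype.ofInjective _ toSum_injective

theorem card_le : Fintype.card (TreeElt m K) ≤ m * m + 2 * (K + 1) := by
  refine (Fintype.card_le_of_injective _ toSum_injective).trans ?_
  simp
  omega

def IsStart : TreeElt m K → Prop
  | cyc _ c => (c : ℕ) = 0
  | lab o => o = none
  | top => True
  | defect _ => True

/-- On the cycle of length `p + 1` the mark sits just before position 0, so walks from a start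
position meet it at depths congruent to -1 modulo `p + 1`. -/
def IsMark : TreeElt m K → Prop
  | cyc p c => (p : ℕ) + 1 ∣ c + 1
  | lab _ => True
  | top => True
  | defect _ => False

/-- Among `top` and the defects only the `i`-edge from `defect i` to `top` is missing, so the
`i`-children of `defect i` are all defective. Positions are compared modulo `p + 1`, since `c`
ranges over all of `Fin m`. -/
def Edge (j : Fin K) : TreeElt m K → TreeElt m K → Prop
  | cyc p c, cyc p' c' => p = p' ∧ c' ≡ c + 1 [MOD p + 1]
  | lab _, lab o => o = some j
  | top, top => True
  | top, defect _ => True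
  | defect i, top => i ≠ j
  | defect _, defect _ => True
  | _, _ => False

/-- `n` levels down all paths with arbitrary edge labels, there is a mark. -/
def HasTree : ℕ → TreeElt m K → Prop
  | 0, x => x.IsMark
  | n + 1, x => ∀ j, ∃ y, Edge j x y ∧ HasTree n y

theorem hasTree_top (n : ℕ) : HasTree n (top : TreeElt m K) := by
  induction n with
  | zero => trivial
  | succ n ih => exact fun j => ⟨top, trivial, ih⟩

theorem hasTree_lab (n : ℕ) (o : Option (Fin K)) : HasTree n (lab o : TreeElt m K) := by
  induction n generalizing o with
  | zero => trivial
  | succ n ih => exact fun j => ⟨lab (some j), rfl, ih _⟩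

theorem hasTree_cyc (n : ℕ) (p c : Fin m) (h : (p : ℕ) + 1 ∣ c + n + 1) :
    HasTree n (cyc p c : TreeElt m K) := by
  induction n generalizing c with
  | zero => exact h
  | succ n ih =>
    intro j
    have hlt : ((c : ℕ) + 1) % (p + 1) < m :=
      (Nat.mod_lt _ (Nat.succ_pos _)).trans_le p.2
    refine ⟨cyc p ⟨((c : ℕ) + 1) % (p + 1), hlt⟩, ⟨rfl, Nat.mod_modEq _ _⟩, ih _ ?_⟩
    have h1 : ((c : ℕ) + 1) % (p + 1) + n + 1 ≡ c + 1 + n + 1 [MOD p + 1] :=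
      ((Nat.mod_modEq _ _).add_right n).add_right 1
    exact (h1.dvd_iff dvd_rfl).2 (by convert h using 1; ring)

/-- Following from each defect its own index never leaves the defects, and these are unmarked. -/
theorem not_hasTree_defect (n : ℕ) (j : Fin K) : ¬ HasTree n (defect j : TreeElt m K) := by
  induction n generalizing j with
  | zero => exact id
  | succ n ih =>
    intro h
    obtain ⟨y, hy, hyn⟩ := h j
    cases y with
    | cyc => exact hy
    | lab => exact hy
    | top => exact hy rfl
    | defect i => exact ih i hyn

end TreeElt

open TreeElt

variable {m K : ℕ}

/-- The unary atom `mark(x)`. -/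
def markAtom {V : Type*} (x : V) : Atom (treeSchema K) V := ⟨TreeRel.mark, fun _ => x⟩

/-- The unary atom `start(x)`. -/
def startAtom {V : Type*} (x : V) : Atom (treeSchema K) V := ⟨TreeRel.start, fun _ => x⟩

/-- The binary atom `edge j (x, y)`. -/
def edgeAtom {V : Type*} (j : Fin K) (x y : V) : Atom (treeSchema K) V :=
  ⟨TreeRel.edge j, (![x, y] : Fin 2 → V)⟩

theorem Atom.mk_congr {σ : Schema.{u}} {V : Type*} (R : σ.Rel) {f g : Fin (σ.arity R) → V}
    (h : ∀ i, f i = g i) : (⟨R, f⟩ : Atom σ V) = ⟨R, g⟩ := congrArg _ (funext h)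

theorem atom_cases {V : Type*} (a : Atom (treeSchema K) V) :
    (∃ x, a = startAtom x) ∨ (∃ x, a = markAtom x) ∨ ∃ j x y, a = edgeAtom j x y := by
  obtain ⟨_ | _ | j, args⟩ := a
  · exact .inl ⟨args (0 : Fin 1), Atom.mk_congr (σ := treeSchema K) TreeRel.start
      fun i => congrArg args (Subsingleton.elim (α := Fin 1) _ _)⟩
  · exact .inr (.inl ⟨args (0 : Fin 1), Atom.mk_congr (σ := treeSchema K) TreeRel.mark
      fun i => congrArg args (Subsingleton.elim (α := Fin 1) _ _)⟩)
  · have : ∀ (f : Fin 2 → V) i, f i = ![f 0, f 1] i := fun f i => by fin_cases i <;> rfl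
    exact .inr (.inr ⟨j, args (0 : Fin 2), args (1 : Fin 2),
      Atom.mk_congr (σ := treeSchema K) (TreeRel.edge j) (this args)⟩)

theorem map_edgeAtom {V W : Type*} (h : V → W) (j : Fin K) (x y : V) :
    (edgeAtom j x y).map h = edgeAtom j (h x) (h y) := by
  have : ∀ i : Fin 2, h (![x, y] i) = ![h x, h y] i := fun i => by fin_cases i <;> rfl
  exact Atom.mk_congr (σ := treeSchema K) (TreeRel.edge j) this

/-- The atoms that are in the database. -/
def Holds (a : Atom (treeSchema K) (TreeElt m K)) : Prop :=
  (∃ x, a = startAtom x ∧ IsStart x) ∨ (∃ x, a = markAtom x ∧ IsMark x) ∨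
    ∃ j x y, a = edgeAtom j x y ∧ Edge j x y

/-- Atoms over this schema as elements of a sum type. -/
noncomputable def atomToSum {V : Type*} (a : Atom (treeSchema K) V) : (V ⊕ V) ⊕ Fin K × V × V :=
  match a with
  | ⟨.start, f⟩ => .inl (.inl (f (0 : Fin 1)))
  | ⟨.mark, f⟩ => .inl (.inr (f (0 : Fin 1)))
  | ⟨.edge j, f⟩ => .inr (j, f (0 : Fin 2), f (1 : Fin 2))

theorem atomToSum_injective {V : Type*} :
    Function.Injective (atomToSum : Atom (treeSchema K) V → _) := by
  intro a b h
  rcases atom_cases a with ⟨x, rfl⟩ | ⟨x, rfl⟩ | ⟨i, x, y, rfl⟩ <;>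
  rcases atom_cases b with ⟨x', rfl⟩ | ⟨x', rfl⟩ | ⟨i', x', y', rfl⟩ <;>
  simp [atomToSum, startAtom, markAtom, edgeAtom] at h ⊢ <;>
  obtain ⟨rfl, rfl, rfl⟩ := h <;> simp

noncomputable instance : Fintype (Atom (treeSchema K) (TreeElt m K)) :=
  Fintype.ofInjective _ atomToSum_injective

open Classical in
/-- The database. -/
noncomputable def treeDB (m K : ℕ) : Database (treeSchema K) (TreeElt m K) :=
  Finset.univ.filter Holds

theorem startAtom_mem {x : TreeElt m K} : startAtom x ∈ treeDB m K ↔ IsStart x := by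
  simp only [treeDB, Finset.mem_filter, Finset.mem_univ, true_and, Holds]
  constructor
  · rintro (⟨y, hy, h⟩ | ⟨y, hy, h⟩ | ⟨j, y, z, hy, h⟩) <;>
      have := congrArg atomToSum hy <;> simp [atomToSum, startAtom, markAtom, edgeAtom] at this
    rwa [this]
  · exact fun h => .inl ⟨x, rfl, h⟩

theorem markAtom_mem {x : TreeElt m K} : markAtom x ∈ treeDB m K ↔ IsMark x := by
  simp only [treeDB, Finset.mem_filter, Finset.mem_univ, true_and, Holds]
  constructor
  · rintro (⟨y, hy, h⟩ | ⟨y, hy, h⟩ | ⟨j, y, z, hy, h⟩) <;>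
      have := congrArg atomToSum hy <;> simp [atomToSum, startAtom, markAtom, edgeAtom] at this
    rwa [this]
  · exact fun h => .inr (.inl ⟨x, rfl, h⟩)

theorem edgeAtom_mem {j : Fin K} {x y : TreeElt m K} : edgeAtom j x y ∈ treeDB m K ↔ Edge j x y := by
  simp only [treeDB, Finset.mem_filter, Finset.mem_univ, true_and, Holds]
  constructor
  · rintro (⟨y, hy, h⟩ | ⟨y, hy, h⟩ | ⟨j, y, z, hy, h⟩) <;>
      have := congrArg atomToSum hy <;> simp [atomToSum, startAtom, markAtom, edgeAtom] at this
    obtain ⟨rfl, rfl, rfl⟩ := this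
    exact h
  · exact fun h => .inr (.inr ⟨j, x, y, rfl, h⟩)

theorem size_atom_le {V : Type*} (a : Atom (treeSchema K) V) : a.size ≤ 3 := by
  rcases atom_cases a with ⟨x, rfl⟩ | ⟨x, rfl⟩ | ⟨i, x, y, rfl⟩ <;>
    simp [Atom.size, startAtom, markAtom, edgeAtom, treeSchema]

theorem size_treeDB_le {c : ℕ} (hc : Fintype.card (TreeElt m K) ≤ c) :
    (treeDB m K).size ≤ 3 * (K + 2) + 3 * (2 * c + K * (c * c)) := by
  refine Nat.add_le_add ?_ ?_
  · have h1 : ∀ R : (treeSchema K).Rel, 1 + (treeSchema K).arity R ≤ 3 := by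
      rintro (_ | _ | _) <;> simp [treeSchema]
    refine (Finset.sum_le_card_nsmul _ _ 3 fun R _ => h1 R).trans ?_
    have : Fintype.card (treeSchema K).Rel = K + 2 := by
      refine (Fintype.card_congr (treeRelEquiv K)).trans ?_
      simp; omega
    rw [Finset.card_univ, this, smul_eq_mul, mul_comm]
  · refine (Finset.sum_le_card_nsmul _ _ 3 fun a _ => size_atom_le a).trans ?_
    rw [smul_eq_mul, mul_comm]
    refine Nat.mul_le_mul_left _ ?_
    refine (Finset.card_le_univ _).trans ?_
    refine (Fintype.card_le_of_injective _ atomToSum_injective).trans ?_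
    simp only [Fintype.card_sum, Fintype.card_prod, Fintype.card_fin]
    have := Nat.mul_le_mul hc hc
    have := Nat.mul_le_mul_left K this
    omega

open Classical in
/-- The positive examples: the start elements that are not defective. -/
noncomputable def treePos (m K : ℕ) : Finset (Fin 1 → TreeElt m K) :=
  Finset.univ.filter fun t => IsStart (t 0) ∧ ∀ j, t 0 ≠ defect j

open Classical in
/-- The negative examples: the defective elements. -/
noncomputable def treeNeg (m K : ℕ) : Finset (Fin 1 → TreeElt m K) :=
  Finset.univ.filter fun t => ∃ j, t 0 = defect j

theorem isOver_of_isStart {S : Finset (Fin 1 → TreeElt m K)} (h : ∀ t ∈ S, IsStart (t 0)) :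
    IsOver S (treeDB m K) := by
  intro t ht i
  rw [Subsingleton.elim i 0]
  exact ⟨startAtom (t 0), startAtom_mem.2 (h t ht), (0 : Fin 1), rfl⟩

/-- The inputs of the lower bound. -/
noncomputable def treeInput (m K : ℕ) : QBEInput.{0, 0} where
  σ := treeSchema K
  C := TreeElt m K
  D := treeDB m K
  arity := 1
  pos := treePos m K
  pos_over := isOver_of_isStart fun t ht => by
    simp only [treePos, Finset.mem_filter, Finset.mem_univ, true_and] at ht
    exact ht.1
  neg := treeNeg m K
  neg_over := isOver_of_isStart fun t ht => by
    simp only [treeNeg, Finset.mem_filter, Finset.mem_univ, true_and] at ht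
    obtain ⟨j, hj⟩ := ht
    rw [hj]
    trivial

theorem size_treeInput_le (n K : ℕ) : (treeInput (2 * n + 4) K).size ≤
    3 * (K + 2) + 3 * (2 * ((2 * n + 4) * (2 * n + 4) + 2 * (K + 1)) +
      K * (((2 * n + 4) * (2 * n + 4) + 2 * (K + 1)) * ((2 * n + 4) * (2 * n + 4) + 2 * (K + 1)))) +
    4 * (1 + ((2 * n + 4) * (2 * n + 4) + 2 * (K + 1))) := by
  have hc := TreeElt.card_le (m := 2 * n + 4) (K := K)
  have h1 := size_treeDB_le hc
  have h2 : ∀ S : Finset (Fin 1 → TreeElt (2 * n + 4) K), relationSize S ≤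
      2 * (1 + ((2 * n + 4) * (2 * n + 4) + 2 * (K + 1))) := by
    intro S
    have : S.card ≤ Fintype.card (TreeElt (2 * n + 4) K) := by
      refine (Finset.card_le_univ _).trans ?_
      simp
    unfold relationSize
    omega
  have h3 := h2 (treePos _ K)
  have h4 := h2 (treeNeg _ K)
  show (treeDB _ K).size + relationSize (treePos _ K) + relationSize (treeNeg _ K) ≤ _
  omega

/-- The formula for `HasTree`, for the variable `0`. -/
noncomputable def treeFm (K k : ℕ) : ℕ → Fm (treeSchema K) (Fin 1) (k + 1)
  | 0 => .atom (markAtom (.inr 0))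
  | n + 1 => .conj (Finset.univ.toList.map fun j =>
      -- Variable `1` takes over the parent and variable `0` is quantified anew as the child. Two
      -- variables suffice, which is why `1 ≤ k` is enough.
      .ex (fun i => if i = 1 then some 0 else none)
        (.and (.atom (edgeAtom j (.inr 1) (.inr 0))) (treeFm K k n)))

theorem sat_treeFm {k : ℕ} (hk : 1 ≤ k) (n : ℕ) (t : Fin 1 → TreeElt m K)
    (d : Fin (k + 1) → TreeElt m K) :
    (treeFm K k n).Sat (treeDB m K : Set _) t d ↔ HasTree n (d 0) := by
  have h01 : (0 : Fin (k + 1)) ≠ 1 := by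
    intro h
    have := congrArg Fin.val h
    rw [Fin.val_zero, Fin.val_one', Nat.mod_eq_of_lt (by omega)] at this
    omega
  induction n generalizing d with
  | zero => exact markAtom_mem
  | succ n ih =>
    simp only [treeFm, Fm.sat_conj, List.mem_map, Finset.mem_toList, Finset.mem_univ, true_and,
      forall_exists_index, forall_apply_eq_imp_iff, HasTree]
    refine forall_congr' fun j => ⟨?_, ?_⟩
    · rintro ⟨d', hd', he, h⟩
      refine ⟨d' 0, ?_, (ih d').1 h⟩
      rw [Fm.Sat, map_edgeAtom] at he
      have he := edgeAtom_mem.1 (Finset.mem_coe.1 he)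
      rwa [Sum.elim_inr, Sum.elim_inr, hd' 1 0 (by simp)] at he
    · rintro ⟨y, hy, h⟩
      refine ⟨fun i => if i = 1 then d 0 else y, fun i j hij => ?_, ?_, (ih _).2 (by simpa [h01] using h)⟩
      · dsimp only at hij ⊢
        split_ifs at hij with h1
        cases hij
        simp [h1]
      · rw [Fm.Sat, map_edgeAtom]
        exact Finset.mem_coe.2 (edgeAtom_mem.2 (by simpa [h01] using hy))

/-- The tree has depth `N + 1 = m! - 1`. From position 0 of a cycle of length at most `m`, a walk of
this length ends at a mark, because the cycle length divides `m!`. -/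
theorem exists_definition {k : ℕ} (hk : 1 ≤ k) (hm : 2 ≤ m) :
    ∃ q ∈ TW (treeSchema K) 1 k, q.eval (treeDB m K) = treePos m K := by
  obtain ⟨N, hN⟩ : ∃ N, N + 2 = m.factorial :=
    ⟨m.factorial - 2, Nat.sub_add_cancel (hm.trans m.self_le_factorial)⟩
  let φ : Fm (treeSchema K) (Fin 1) (k + 1) := .and (.atom (startAtom (.inl 0)))
    (.conj (Finset.univ.toList.map fun j => .ex (fun _ => none)
      (.and (.atom (edgeAtom j (.inl 0) (.inr 0))) (treeFm K k N))))
  have hφ : ∀ (t : Fin 1 → TreeElt m K) d, φ.Sat (treeDB m K : Set _) t d ↔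
      IsStart (t 0) ∧ HasTree (N + 1) (t 0) := by
    intro t d
    refine and_congr startAtom_mem ?_
    simp only [Fm.sat_conj, List.mem_map, Finset.mem_toList, Finset.mem_univ, true_and,
      forall_exists_index, forall_apply_eq_imp_iff, HasTree]
    refine forall_congr' fun j => ⟨?_, ?_⟩
    · rintro ⟨d', hd', he, h⟩
      refine ⟨d' 0, ?_, (sat_treeFm hk _ _ d').1 h⟩
      rw [Fm.Sat, map_edgeAtom] at he
      exact edgeAtom_mem.1 (Finset.mem_coe.1 he)
    · rintro ⟨y, hy, h⟩
      refine ⟨fun _ => y, fun i j hij => by simp at hij, ?_, (sat_treeFm hk _ _ _).2 h⟩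
      rw [Fm.Sat, map_edgeAtom]
      exact Finset.mem_coe.2 (edgeAtom_mem.2 hy)
  obtain ⟨q, hq, -, hfree, hev⟩ := φ.exists_cq (fun i => i) (fun i => i.2) ⟨_, .inl rfl⟩ (fun i =>
    ⟨_, .inl rfl, 0, ⟨(0 : Fin 1), rfl⟩, by rw [Subsingleton.elim i 0]⟩)
  refine ⟨q, hq, Set.ext fun t => ?_⟩
  have h1 : t ∈ q.eval (treeDB m K) ↔ ∃ d, φ.Sat (treeDB m K : Set _) t d := by
    have := hev (treeDB m K : Set (Atom (treeSchema K) (TreeElt m K))) (fun _ => t 0)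
    have ht : (fun _ => t 0) ∘ (fun i : Fin 1 => (i : ℕ)) = t :=
      funext fun i => by rw [Subsingleton.elim i 0]; rfl
    rw [ht] at this
    rw [← this]
    refine exists_congr fun h => and_congr_right fun _ => ?_
    rw [hfree]
    exact eq_comm
  rw [h1]
  simp only [hφ, treePos, Finset.coe_filter, Finset.mem_univ, true_and, Set.mem_ofPred_eq]
  have : Nonempty (Fin (k + 1) → TreeElt m K) := ⟨fun _ => top⟩
  refine (exists_const _).trans (and_congr_right fun hs => ⟨fun h j hj => ?_, fun h => ?_⟩)
  · rw [hj] at h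
    exact not_hasTree_defect _ _ h
  · generalize t 0 = x at *
    cases x with
    | cyc p c =>
      refine hasTree_cyc _ _ _ ?_
      have hc : (c : ℕ) = 0 := hs
      rw [hc, zero_add, hN]
      exact Nat.dvd_factorial (Nat.succ_pos _) p.2
    | lab o => exact hasTree_lab _ _
    | top => exact hasTree_top _
    | defect j => exact absurd rfl (h j)

end QBE

/-! ### The lower bound: every explanation is large -/

namespace QBE

open TreeElt

theorem exists_vars {σ : Schema.{u}} (l : List (Atom σ ℕ)) :
    ∃ S : Finset ℕ, (∀ a ∈ l, ∀ x, a.Mentions x → x ∈ S) ∧ S.card ≤ (l.map Atom.size).sum := by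
  classical
  induction l with
  | nil => exact ⟨∅, by simp, by simp⟩
  | cons a l ih =>
    obtain ⟨S, hS, hcard⟩ := ih
    refine ⟨Finset.univ.image a.args ∪ S, ?_, ?_⟩
    · intro b hb x hx
      rcases List.mem_cons.1 hb with rfl | hb
      · obtain ⟨i, rfl⟩ := hx
        exact Finset.mem_union_left _ (Finset.mem_image_of_mem _ (Finset.mem_univ _))
      · exact Finset.mem_union_right _ (hS b hb x hx)
    · refine (Finset.card_union_le _ _).trans ?_
      have : (Finset.univ.image a.args).card ≤ σ.arity a.rel := Finset.card_image_le.trans (by simp)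
      simp only [List.map_cons, List.sum_cons, Atom.size] at *
      omega

theorem CQ.exists_orientation {σ : Schema.{u}} {n k : ℕ} {q : CQ σ n} (hq : q ∈ TW σ n k) :
    ∃ N : ℕ → Finset ℕ, (∀ x, (N x).card ≤ k) ∧ ∀ a ∈ q.atoms, ∀ x ∈ q.existentialVars,
      ∀ y ∈ q.existentialVars, x ≠ y → a.Mentions x → a.Mentions y → y ∈ N x ∨ x ∈ N y := by
  classical
  obtain ⟨L, hL, -, he⟩ := BagSeq.exists_of_treewidthLE hq
  obtain ⟨N, hN, h⟩ := hL.exists_orientation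
  refine ⟨fun x => if hx : x ∈ q.existentialVars then (N ⟨x, hx⟩).map (.subtype _) else ∅, ?_, ?_⟩
  · intro x
    dsimp only
    split_ifs
    · rw [Finset.card_map]; exact hN _
    · simp
  · intro a ha x hx y hy hxy hax hay
    obtain ⟨B, hB, hxB, hyB⟩ := he ⟨x, hx⟩ ⟨y, hy⟩ ⟨fun h => hxy (congrArg Subtype.val h), a, ha, hax, hay⟩
    simp only [dif_pos hx, dif_pos hy]
    refine (h B hB _ hxB _ hyB fun h => hxy (congrArg Subtype.val h)).imp ?_ ?_ <;>
    · intro h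
      exact Finset.mem_map.2 ⟨_, h, rfl⟩

/-- If all vertices in `U` have `2 * k` distinct children in `U'`, where the edges to the children can be
oriented with out-degrees at most `k`, then `U'` is at least twice as large as `U`. -/
theorem two_mul_card_le {k : ℕ} (hk : 1 ≤ k) {N : ℕ → Finset ℕ} (hN : ∀ x, (N x).card ≤ k)
    {U U' : Finset ℕ} {c : ℕ → Fin (2 * k) → ℕ} (hUU' : U ⊆ U') (hc : ∀ v ∈ U, ∀ j, c v j ∈ U')
    (hinj : ∀ v ∈ U, Function.Injective (c v))
    (hacyc : ∀ v ∈ U, ∀ w ∈ U, ∀ i j, c v i = w → c w j ≠ v)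
    (hor : ∀ v ∈ U, ∀ j, c v j ∈ N v ∨ v ∈ N (c v j)) : 2 * U.card ≤ U'.card := by
  classical
  -- Each parent-child edge is sent to its orientation, with the tail first. By `hacyc` an edge does
  -- not arise from both of its ends, so the `2 * k * U.card` edges inject into at most `k *
  -- U'.card` outgoing pairs.
  let f : ℕ × Fin (2 * k) → (_ : ℕ) × ℕ := fun x =>
    if c x.1 x.2 ∈ N x.1 then ⟨x.1, c x.1 x.2⟩ else ⟨c x.1 x.2, x.1⟩
  have h1 : (U ×ˢ (Finset.univ : Finset (Fin (2 * k)))).card ≤ (U'.sigma N).card := by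
    refine Finset.card_le_card_of_injOn f ?_ ?_
    · rintro ⟨v, j⟩ hv
      have hv : v ∈ U := by simpa using hv
      simp only [f]
      split_ifs with h
      · exact Finset.mem_sigma.2 ⟨hUU' hv, h⟩
      · exact Finset.mem_sigma.2 ⟨hc v hv j, (hor v hv j).resolve_left h⟩
    · rintro ⟨v, i⟩ hv ⟨w, j⟩ hw hvw
      have hv : v ∈ U := by simpa using hv
      have hw : w ∈ U := by simpa using hw
      simp only [f] at hvw
      split_ifs at hvw with h1 h2 h2 <;>
        simp only [Sigma.mk.injEq, heq_eq_eq] at hvw <;> obtain ⟨h3, h4⟩ := hvw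
      · subst h3
        rw [hinj v hv h4]
      · exact absurd h3.symm (hacyc v hv w hw i j h4)
      · exact absurd h4.symm (hacyc v hv w hw i j h3)
      · subst h4
        rw [hinj v hv h3]
  rw [Finset.card_product, Finset.card_univ, Fintype.card_fin, Finset.card_sigma] at h1
  have h2 : ∑ x ∈ U', (N x).card ≤ U'.card * k := by
    simpa using Finset.sum_le_card_nsmul U' _ k fun x _ => hN x
  have h3 : k * (2 * U.card) ≤ k * U'.card := by linarith
  exact Nat.le_of_mul_le_mul_left h3 hk

section LowerBound

variable {m K : ℕ} (q : CQ (treeSchema K) 1)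

/-- The variables below which, whatever edge labels are chosen, the query demands a mark. -/
inductive Forced : ℕ → Prop
  | mark (v : ℕ) (h : markAtom v ∈ q.atoms) : Forced v
  | step (v : ℕ) (c : Fin K → ℕ) (h : ∀ j, edgeAtom j v (c j) ∈ q.atoms) (h' : ∀ j, Forced (c j)) :
      Forced v

/-- The forced variables at distance `i` below the free variable. -/
inductive Level : ℕ → ℕ → Prop
  | root : Level 0 (q.free 0)
  | succ (i v w : ℕ) (j : Fin K) (h : Level i v) (he : edgeAtom j v w ∈ q.atoms) (hw : Forced q w) :
      Level (i + 1) w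

variable {q}

/-- An unforced variable has a label all of whose children are unforced too. Sending it to the
defect of this label, and forced variables to `top`, is a homomorphism; an unforced free variable
would thus yield a negative example. -/
theorem forced_free (hneg : q.eval (treeDB m K) ∩ (treeNeg m K : Set (Fin 1 → TreeElt m K)) = ∅) :
    Forced q (q.free 0) := by
  classical
  by_contra hx
  have hex : ∀ v, ¬ Forced q v → ∃ j, ∀ w, edgeAtom j v w ∈ q.atoms → ¬ Forced q w := by
    intro v hv
    by_contra! h
    choose c hc hc' using h
    exact hv (.step v c hc hc')
  have : Nonempty (Fin K) := ⟨(hex _ hx).choose⟩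
  choose! f hf using hex
  let g : ℕ → TreeElt m K := fun v => if Forced q v then top else defect (f v)
  have hg : IsHom q.canonicalDB (treeDB m K : Set (Atom (treeSchema K) (TreeElt m K))) g := by
    intro a ha
    rcases atom_cases a with ⟨v, rfl⟩ | ⟨v, rfl⟩ | ⟨j, v, w, rfl⟩
    · refine (startAtom_mem (x := g v)).2 ?_
      simp only [g]
      split_ifs <;> trivial
    · refine (markAtom_mem (x := g v)).2 ?_
      simp only [g]
      rw [if_pos (Forced.mark v ha)]
      trivial
    · rw [map_edgeAtom]
      refine edgeAtom_mem.2 ?_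
      simp only [g]
      split_ifs with h1 h2 h2
      · trivial
      · trivial
      · exact fun h => hf v h1 w (h ▸ ha) h2
      · trivial
  have : (fun i => g (q.free i)) ∈ q.eval (treeDB m K) ∩ (treeNeg m K : Set (Fin 1 → TreeElt m K)) := by
    refine ⟨⟨g, hg, rfl⟩, ?_⟩
    simp only [treeNeg, Finset.coe_filter, Finset.mem_univ, true_and, Set.mem_ofPred_eq]
    exact ⟨f (q.free 0), if_neg hx⟩
  rw [hneg] at this
  exact this

theorem exists_isHom_of_pos (hpos : (treePos m K : Set (Fin 1 → TreeElt m K)) ⊆ q.eval (treeDB m K))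
    {x : TreeElt m K} (hx : IsStart x) (hx' : ∀ j, x ≠ defect j) :
    ∃ h : ℕ → TreeElt m K, h (q.free 0) = x ∧
      (∀ v, markAtom v ∈ q.atoms → IsMark (h v)) ∧
      ∀ j v w, edgeAtom j v w ∈ q.atoms → Edge j (h v) (h w) := by
  obtain ⟨h, hh, ht⟩ := hpos (a := fun _ => x) (by simpa [treePos] using ⟨hx, hx'⟩)
  refine ⟨h, (congrFun ht 0).symm, fun v hv => markAtom_mem.1 (hh _ hv), fun j v w hv => ?_⟩
  have := hh _ hv
  rw [map_edgeAtom] at this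
  exact edgeAtom_mem.1 (Finset.mem_coe.1 this)

variable (hpos : (treePos m K : Set (Fin 1 → TreeElt m K)) ⊆ q.eval (treeDB m K))
include hpos

/-- Position 0 of each cycle is a positive example. Edges advance by one position, so the
homomorphism records levels modulo `p + 1`. -/
theorem exists_hom_cyc (p : Fin m) :
    ∃ h : ℕ → TreeElt m K, (∀ v, markAtom v ∈ q.atoms → IsMark (h v)) ∧
      ∀ i v, Level q i v → ∃ c : Fin m, h v = cyc p c ∧ c ≡ i [MOD p + 1] := by
  obtain ⟨h, h0, hmark, hedge⟩ := exists_isHom_of_pos hpos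
    (x := cyc p ⟨0, p.pos⟩) rfl (by simp)
  refine ⟨h, hmark, fun i v hv => ?_⟩
  induction hv with
  | root => exact ⟨_, h0, rfl⟩
  | succ i v w j _ he _ ih =>
    obtain ⟨c, hc, hci⟩ := ih
    have := hedge j v w he
    rw [hc] at this
    generalize h w = y at *
    cases y with
    | cyc p' c' =>
      obtain ⟨rfl, h2⟩ := this
      exact ⟨c', rfl, h2.trans (hci.add_right 1)⟩
    | lab => exact this.elim
    | top => exact this.elim
    | defect => exact this.elim

theorem lcmUpto_dvd_of_mark {i v : ℕ} (hv : Level q i v) (hm : markAtom v ∈ q.atoms) :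
    Nat.lcmUpto m ∣ i + 1 := by
  refine Finset.lcm_dvd fun b hb => ?_
  rw [Finset.mem_Icc] at hb
  obtain ⟨h, hmark, hlev⟩ := exists_hom_cyc hpos ⟨b - 1, by omega⟩
  obtain ⟨c, hc, hci⟩ := hlev i v hv
  have hmk := hmark v hm
  rw [hc] at hmk
  have hmk : b - 1 + 1 ∣ (c : ℕ) + 1 := hmk
  have hci : c ≡ i [MOD b - 1 + 1] := hci
  have := ((hci.add_right 1).dvd_iff dvd_rfl).1 hmk
  rwa [Nat.sub_add_cancel hb.1] at this

/-- All the cycles together determine the level modulo lcm(1, ..., m), hence exactly below this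
bound. -/
theorem level_unique {i i' v : ℕ} (hv : Level q i v) (hv' : Level q i' v) (hi : i < Nat.lcmUpto m)
    (hi' : i' < Nat.lcmUpto m) : i = i' := by
  have : i ≡ i' [MOD Nat.lcmUpto m] := by
    rw [Nat.modEq_iff_dvd]
    have : ∀ b ∈ Finset.Icc 1 m, (b : ℤ) ∣ (i' : ℤ) - i := by
      intro b hb
      rw [Finset.mem_Icc] at hb
      obtain ⟨h, -, hlev⟩ := exists_hom_cyc hpos ⟨b - 1, by omega⟩
      obtain ⟨c, hc, hci⟩ := hlev i v hv
      obtain ⟨c', hc', hci'⟩ := hlev i' v hv'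
      rw [hc] at hc'
      cases hc'
      have := hci.symm.trans hci'
      simp only [Nat.sub_add_cancel hb.1] at this
      exact Nat.modEq_iff_dvd.1 this
    rw [← Int.dvd_natAbs, Int.natCast_dvd_natCast]
    refine Finset.lcm_dvd fun b hb => ?_
    have := this b hb
    rwa [← Int.dvd_natAbs, Int.natCast_dvd_natCast] at this
  exact this.eq_of_lt_of_lt hi hi'

/-- The positive example `lab none` leads to a structure that remembers the last label, so children
along different labels are different variables. -/
theorem edge_label_unique {i v w : ℕ} (hv : Level q i v) {j j' : Fin K}
    (h : edgeAtom j v w ∈ q.atoms) (h' : edgeAtom j' v w ∈ q.atoms) : j = j' := by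
  obtain ⟨g, h0, -, hedge⟩ := exists_isHom_of_pos hpos (x := lab none) rfl (by simp)
  have key : ∀ {j : Fin K} {v w : ℕ}, (∃ o, g v = lab o) → edgeAtom j v w ∈ q.atoms →
      g w = lab (some j) := by
    rintro j v w ⟨o, ho⟩ he
    have := hedge j v w he
    rw [ho] at this
    generalize g w = y at *
    cases y with
    | cyc => exact this.elim
    | lab o' => exact congrArg lab this
    | top => exact this.elim
    | defect => exact this.elim
  have hlab : ∃ o, g v = lab o := by
    induction hv with
    | root => exact ⟨_, h0⟩
    | succ i v w j hv he _ ih =>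
      have : ∀ {i v : ℕ}, Level q i v → ∃ o, g v = lab o := by
        intro i v hv
        induction hv with
        | root => exact ⟨_, h0⟩
        | succ i v w j _ he _ ih => exact ⟨_, key ih he⟩
      exact ⟨_, key (this hv) he⟩
  have h1 := key hlab h
  rw [key hlab h'] at h1
  cases h1
  rfl

end LowerBound

/-- As `N` is below the lcm, no mark occurs on levels below `N`, so all their variables have `2 * k`
forced children, and levels up to `N` are unique, so parent-child edges are never reversed. The sets
`U i` start at level 1 because treewidth does not constrain the free variable; its `2 * k` children
start the doubling. -/
theorem two_pow_le_size {m k N : ℕ} (hk : 1 ≤ k) (hN : 1 ≤ N) (hNm : N < Nat.lcmUpto m)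
    {q : CQ (treeSchema (2 * k)) 1} (hq : q ∈ TW (treeSchema (2 * k)) 1 k)
    (hpos : (treePos m (2 * k) : Set (Fin 1 → TreeElt m (2 * k))) ⊆ q.eval (treeDB m (2 * k)))
    (hneg : q.eval (treeDB m (2 * k)) ∩ (treeNeg m (2 * k) : Set (Fin 1 → TreeElt m (2 * k))) = ∅) :
    2 ^ N ≤ q.size := by
  classical
  have hroot := forced_free hneg
  obtain ⟨S, hS, hScard⟩ := exists_vars q.atoms
  obtain ⟨O, hO, hor⟩ := CQ.exists_orientation hq
  have hforced : ∀ i v, Level q i v → Forced q v := by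
    intro i v hv
    cases hv with
    | root => exact hroot
    | succ _ _ _ _ _ _ hw => exact hw
  have hchild : ∀ v, (∃ i < N, Level q i v) → ∃ c : Fin (2 * k) → ℕ,
      ∀ j, edgeAtom j v (c j) ∈ q.atoms ∧ Forced q (c j) := by
    rintro v ⟨i, hi, hv⟩
    cases hforced i v hv with
    | mark _ h =>
      have := Nat.le_of_dvd (Nat.succ_pos _) (lcmUpto_dvd_of_mark hpos hv h)
      omega
    | step _ c h h' => exact ⟨c, fun j => ⟨h j, h' j⟩⟩
  choose! c hc using hchild
  let U : ℕ → Finset ℕ := fun i => S.filter fun v => ∃ i', 1 ≤ i' ∧ i' ≤ i ∧ Level q i' v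
  have memS : ∀ {j v w}, edgeAtom j v w ∈ q.atoms → w ∈ S := fun h => hS _ h _ ⟨(1 : Fin 2), rfl⟩
  have memU : ∀ i i' v j, i' < N → i' ≤ i → Level q i' v → c v j ∈ U (i + 1) := by
    intro i i' v j hi' hi hv
    obtain ⟨h1, h2⟩ := hc v ⟨i', hi', hv⟩ j
    exact Finset.mem_filter.2 ⟨memS h1, i' + 1, by omega, by omega, .succ _ _ _ _ hv h1 h2⟩
  have cinj : ∀ i' v, i' < N → Level q i' v → Function.Injective (c v) := by
    intro i' v hi' hv j j' hjj'
    have h1 := (hc v ⟨i', hi', hv⟩ j).1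
    have h2 := (hc v ⟨i', hi', hv⟩ j').1
    rw [← hjj'] at h2
    exact edge_label_unique hpos hv h1 h2
  have hex : ∀ i ≤ N, ∀ v ∈ U i, v ∈ q.existentialVars := by
    intro i hi v hv
    obtain ⟨-, i', hi'1, hi', hlev⟩ := Finset.mem_filter.1 hv
    constructor
    · cases hlev with
      | root => omega
      | succ _ _ _ _ _ he _ => exact ⟨_, he, (1 : Fin 2), rfl⟩
    · rintro ⟨j, hj⟩
      rw [Subsingleton.elim j 0] at hj
      have h0 : Level q 0 v := hj ▸ .root
      have := level_unique hpos h0 hlev (by omega) (by omega)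
      omega
  have hcard : ∀ i, 1 ≤ i → i ≤ N → 2 ^ i ≤ (U i).card := by
    intro i hi
    induction i, hi using Nat.le_induction with
    | base =>
      intro hN
      have h1 : (Finset.univ.image (c (q.free 0))).card ≤ (U 1).card :=
        Finset.card_le_card fun w hw => by
          obtain ⟨j, -, rfl⟩ := Finset.mem_image.1 hw
          exact memU 0 0 _ j (by omega) le_rfl .root
      rw [Finset.card_image_of_injective _ (cinj 0 _ (by omega) .root), Finset.card_univ,
        Fintype.card_fin] at h1
      omega
    | succ i hi ih =>
      intro hiN
      have hlt : ∀ v ∈ U i, ∃ i' < N, i' ≤ i ∧ Level q i' v := by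
        intro v hv
        obtain ⟨-, i', -, hi', hlev⟩ := Finset.mem_filter.1 hv
        exact ⟨i', by omega, hi', hlev⟩
      have hsucc : ∀ v j i', i' < N → Level q i' v → Level q (i' + 1) (c v j) := fun v j i' hi' hlev =>
        .succ _ _ _ _ hlev (hc v ⟨i', hi', hlev⟩ j).1 (hc v ⟨i', hi', hlev⟩ j).2
      have hsub : U i ⊆ U (i + 1) := by
        intro v hv
        obtain ⟨hvS, i', h1, h2, h3⟩ := Finset.mem_filter.1 hv
        exact Finset.mem_filter.2 ⟨hvS, i', h1, by omega, h3⟩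
      have hmem : ∀ v ∈ U i, ∀ j, c v j ∈ U (i + 1) := by
        intro v hv j
        obtain ⟨i', h1, h2, h3⟩ := hlt v hv
        exact memU i i' v j h1 h2 h3
      have := two_mul_card_le hk hO (U := U i) (U' := U (i + 1)) (c := c) hsub hmem ?_ ?_ ?_
      · have := ih (by omega)
        rw [pow_succ]
        omega
      · intro v hv
        obtain ⟨i', h1, h2, h3⟩ := hlt v hv
        exact cinj i' v h1 h3
      · rintro v hv w hw j j' rfl hvw
        obtain ⟨i1, h1, h2, h3⟩ := hlt v hv
        obtain ⟨i2, h4, h5, h6⟩ := hlt _ hw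
        have e1 := level_unique hpos (hsucc v j i1 h1 h3) h6 (by omega) (by omega)
        have e2 := hsucc _ j' i2 h4 h6
        rw [hvw] at e2
        have e3 := level_unique hpos e2 h3 (by omega) (by omega)
        omega
      · intro v hv j
        obtain ⟨i', h1, h2, h3⟩ := hlt v hv
        refine hor _ (hc v ⟨i', h1, h3⟩ j).1 v (hex i (by omega) v hv) _ (hex (i + 1) hiN _ (hmem v hv j))
          ?_ ⟨(0 : Fin 2), rfl⟩ ⟨(1 : Fin 2), rfl⟩
        intro heq
        have e2 := hsucc v j i' h1 h3
        rw [← heq] at e2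
        have := level_unique hpos h3 e2 (by omega) (by omega)
        omega
  calc 2 ^ N ≤ (U N).card := hcard N hN le_rfl
    _ ≤ S.card := Finset.card_le_card (Finset.filter_subset _ _)
    _ ≤ (q.atoms.map Atom.size).sum := hScard
    _ ≤ q.size := Nat.le_add_left _ _

/-- By a bound of Chebyshev type the lcm falls short of `2 ^ (2 * n + 4)` only by a small factor,
which the surplus `2 ^ (n + 4)` outgrows. -/
theorem two_pow_lt_lcmUpto (n : ℕ) : 2 ^ n < Nat.lcmUpto (2 * n + 4) := by
  by_contra! h
  have h1 := Chebyshev.two_pow_le_mul_lcmUpto (2 * n + 4)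
  have h2 := h1.trans (Nat.mul_le_mul_left _ h)
  rw [show 2 * n + 4 = (n + 4) + n by ring, pow_add] at h2
  have h3 := Nat.le_of_mul_le_mul_right h2 (by positivity)
  have h4 : n < 2 ^ n := Nat.lt_two_pow_self
  rw [pow_add] at h3
  omega

/-- Positive and negative examples are disjoint, so definitions are explanations and one family
serves both lower bounds. -/
theorem exists_input_of_large_explanations {k : ℕ} (hk : 1 ≤ k) :
    ∃ I : ℕ → QBEInput.{0, 0}, (∃ p : Polynomial ℕ, ∀ n, (I n).size ≤ p.eval n) ∧
      ∀ n, ((I n).toDefinabilityInput.definitions k).Nonempty ∧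
        (I n).toDefinabilityInput.definitions k ⊆ (I n).explanations k ∧
        ∀ q ∈ (I n).explanations k, 2 ^ (2 ^ n) ≤ q.size := by
  refine ⟨fun n => treeInput (2 * n + 4) (2 * k), ⟨3 * (.C (2 * k) + 2) +
    3 * (2 * ((2 * .X + 4) * (2 * .X + 4) + 2 * (.C (2 * k) + 1)) + .C (2 * k) *
      (((2 * .X + 4) * (2 * .X + 4) + 2 * (.C (2 * k) + 1)) *
        ((2 * .X + 4) * (2 * .X + 4) + 2 * (.C (2 * k) + 1)))) +
    4 * (1 + ((2 * .X + 4) * (2 * .X + 4) + 2 * (.C (2 * k) + 1))), fun n => ?_⟩, fun n => ⟨?_, ?_, ?_⟩⟩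
  · refine (size_treeInput_le n (2 * k)).trans (le_of_eq ?_)
    simp only [Polynomial.eval_add, Polynomial.eval_mul, Polynomial.eval_X, Polynomial.eval_C,
      Polynomial.eval_ofNat, Polynomial.eval_one]
  · obtain ⟨q, hq, h⟩ := exists_definition (m := 2 * n + 4) (K := 2 * k) hk (by omega)
    exact ⟨q, hq, h⟩
  · rintro q ⟨hq, h⟩
    refine ⟨hq, h.ge, ?_⟩
    rw [h, Set.eq_empty_iff_forall_notMem]
    rintro t ⟨h1, h2⟩
    have h1 : t ∈ (treePos (2 * n + 4) (2 * k) : Set (Fin 1 → TreeElt _ _)) := h1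
    have h2 : t ∈ (treeNeg (2 * n + 4) (2 * k) : Set (Fin 1 → TreeElt _ _)) := h2
    simp only [treePos, treeNeg, Finset.coe_filter, Finset.mem_univ, true_and] at h1 h2
    obtain ⟨j, hj⟩ := h2
    exact h1.2 j hj
  · rintro q ⟨hq, h1, h2⟩
    exact two_pow_le_size hk Nat.one_le_two_pow (two_pow_lt_lcmUpto n) hq h1 h2

end QBE

theorem proposition5 (k : ℕ) (hk : 1 ≤ k) :
    -- explanations: double exponential upper bound
    (∃ p : Polynomial ℕ, ∀ I : QBE.QBEInput.{u, v}, (I.explanations k).Nonempty →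
      ∃ q ∈ I.explanations k, q.size ≤ 2 ^ (2 ^ p.eval I.size)) ∧
    -- explanations: double exponential lower bound
    (∃ I : ℕ → QBE.QBEInput.{0, 0}, (∃ p : Polynomial ℕ, ∀ n, (I n).size ≤ p.eval n) ∧
      ∀ n, ((I n).explanations k).Nonempty ∧
        ∀ q ∈ (I n).explanations k, 2 ^ (2 ^ n) ≤ q.size) ∧
    -- definitions: double exponential upper bound
    (∃ p : Polynomial ℕ, ∀ I : QBE.DefinabilityInput.{u, v}, (I.definitions k).Nonempty →
      ∃ q ∈ I.definitions k, q.size ≤ 2 ^ (2 ^ p.eval I.size)) ∧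
    -- definitions: double exponential lower bound
    (∃ I : ℕ → QBE.DefinabilityInput.{0, 0}, (∃ p : Polynomial ℕ, ∀ n, (I n).size ≤ p.eval n) ∧
      ∀ n, ((I n).definitions k).Nonempty ∧
        ∀ q ∈ (I n).definitions k, 2 ^ (2 ^ n) ≤ q.size) := by
  obtain ⟨I, ⟨p, hp⟩, hI⟩ := QBE.exists_input_of_large_explanations hk
  refine ⟨QBE.exists_explanation_le k, ⟨I, ⟨p, hp⟩, fun n => ⟨(hI n).1.mono (hI n).2.1, (hI n).2.2⟩⟩,
    QBE.exists_definition_le k, fun n => (I n).toDefinabilityInput,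
    ⟨p, fun n => (Nat.le_add_right _ _).trans (hp n)⟩,
    fun n => ⟨(hI n).1, fun q hq => (hI n).2.2 q ((hI n).2.1 hq)⟩⟩
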